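/- Let $\alpha\in\mathbb{C}$ with $\operatorname{Re}\alpha>0$. For $-\infty\le a<b\le\infty$ let $J[f](x)=\int_a^x f(y)\,dy$ be the integration operator and $$\widetilde J^{\alpha}[f](x)=\frac1{\Gamma(\alpha)}\int_a^x f(y)(x-y)^{\alpha-1}\,dy$$ the Riemann–Liouville fractional integral. Put $P_n(\alpha)=\frac{(-1)^n}{n!}\prod_{m=0}^{n-1}(\alpha-m)$. Then $J^\alpha=\widetilde J^\alpha$ in the following sense. 1. Let $-\infty<a<b<\infty$. Then $J$ and $\widetilde J^\alpha$ are bounded operators on the complex space $L^1(a,b)$, and $\widetilde J^\alpha$ is the fractional power $J^\alpha$ of $J$: $$\widetilde J^\alpha=\lim_{\varepsilon\to0^+}(J+\varepsilon)^\alpha,\qquad (J+\varepsilon)^\alpha=\frac1{2\pi i}\oint_{\Gamma_\varepsilon}\lambda^\alpha(\lambda-J-\varepsilon)^{-1}\,d\lambda,$$ where $\Gamma_\varepsilon$ is a circle that encloses the spectrum of $J+\varepsilon$ and bounds a closed disc in $\mathbb{C}\setminus(-\infty,0]$, and $\lambda^\alpha$ is the principal branch; and for every $\rho>0$ $$\widetilde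 J^\alpha=\sum_{n=0}^\infty\Big[\sum_{k=0}^nP_k(n)\rho^{\alpha-k}J^k\Big]P_n(\alpha).$$ The limit and the series (its sequence of partial sums) converge in the operator norm. 2. Let $-\infty\le a<b\le\infty$, $\rho>0$ and $f\in L^1(a,b)$; if $a=-\infty$, suppose also that $f(x)=\mathcal{O}(e^{\varepsilon x})$ as $x\to-\infty$ (for almost every $x$) for some $\varepsilon>1/\rho$. Let $c\le b$ be a finite real number. Then $J^kf\in L^1(a,c)$ for all $k\ge 0$, the integral that defines $\widetilde J^\alpha[f](x)$ converges absolutely for almost every $x\in(a,c)$, $\widetilde J^\alpha[f]\in L^1(a,c)$, and $$\widetilde J^\alpha[f]=\sum_{n=0}^\infty\Big[\sum_{k=0}^nP_k(n)\rho^{\alpha-k}J^k[f]\Big]P_n(\alpha)$$ with convergence of the partial sums in the norm of $L^1(a,c)$. -/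

import Mathlib

open MeasureTheory Filter Topology Set

noncomputable section

namespace FracInt

/-! ### Interpolation of integer powers -/

/-- The Pochhammer-Newton polynomial `P_n(α) = (-1)^n / n! * ∏_{m < n} (α - m)`. -/
def pochhammerNewton (n : ℕ) (α : ℂ) : ℂ :=
  (-1) ^ n / (n.factorial : ℂ) * ∏ m ∈ Finset.range n, (α - m)

/-- The `N`-th partial sum of the Newton series
`∑_n (∑_{k ≤ n} P_k(n) ρ^(α - k) T^k) P_n(α)` of a bounded operator `T`. -/
def newtonSum {X : Type*} [NormedAddCommGroup X] [NormedSpace ℂ X]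
    (ρ : ℝ) (α : ℂ) (T : X →L[ℂ] X) (N : ℕ) : X →L[ℂ] X :=
  ∑ n ∈ Finset.range N, pochhammerNewton n α •
    ∑ k ∈ Finset.range (n + 1), (pochhammerNewton k n * (ρ : ℂ) ^ (α - k)) • T ^ k

/-! ### Fractional powers through the holomorphic functional calculus -/

/-- `S = (2πi)⁻¹ ∮_Γ λ^α (λ - T)⁻¹ dλ`, where `Γ` is a circle that encloses the spectrum of `T` and
bounds a disc in the slit plane, on which the principal branch of `λ^α` is holomorphic. By Cauchy's
theorem `S` does not depend on the choice of `Γ`. -/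
def IsHolomorphicPower {X : Type*} [NormedAddCommGroup X] [NormedSpace ℂ X]
    (T : X →L[ℂ] X) (α : ℂ) (S : X →L[ℂ] X) : Prop :=
  ∃ (c : ℂ) (R : ℝ), Metric.closedBall c R ⊆ Complex.slitPlane ∧
    spectrum ℂ T ⊆ Metric.ball c R ∧
    S = (2 * Real.pi * Complex.I : ℂ)⁻¹ • ∮ z in C(c, R), z ^ α • resolvent T z

/-- `S = T^α`, understood as `lim_{ε → 0+} (T + ε)^α` in the operator norm, each `(T + ε)^α` being
given by the holomorphic functional calculus. -/
def IsFractionalPower {X : Type*} [NormedAddCommGroup X] [NormedSpace ℂ X]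
    (T : X →L[ℂ] X) (α : ℂ) (S : X →L[ℂ] X) : Prop :=
  ∃ E : ℝ → (X →L[ℂ] X),
    (∀ ε : ℝ, 0 < ε → IsHolomorphicPower (T + (ε : ℂ) • ContinuousLinearMap.id ℂ X) α (E ε)) ∧
    Tendsto E (𝓝[>] 0) (𝓝 S)

/-! ### Integration and the Riemann-Liouville integral, on functions -/

/-- The open interval `(a, b)` of real numbers, with endpoints that may be infinite. -/
def interval (a b : EReal) : Set ℝ := {x : ℝ | a < (x : EReal) ∧ (x : EReal) < b}

/-- `J[f](x) = ∫_a^x f(y) dy`. -/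
def integ (a : EReal) (f : ℝ → ℂ) (x : ℝ) : ℂ := ∫ y in interval a x, f y

/-- The Riemann-Liouville integral `Γ(α)⁻¹ ∫_a^x f(y) (x - y)^(α - 1) dy`. -/
def riemannLiouville (a : EReal) (α : ℂ) (f : ℝ → ℂ) (x : ℝ) : ℂ :=
  (Complex.Gamma α)⁻¹ * ∫ y in interval a x, f y * ((x - y : ℝ) : ℂ) ^ (α - 1)

/-- The partial sums of the Newton series of `J`, applied to a function `f`. -/
def newtonSumFun (a : EReal) (ρ : ℝ) (α : ℂ) (f : ℝ → ℂ) (N : ℕ) (x : ℝ) : ℂ :=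
  ∑ n ∈ Finset.range N, pochhammerNewton n α *
    ∑ k ∈ Finset.range (n + 1),
      pochhammerNewton k n * (ρ : ℂ) ^ (α - k) * (integ a)^[k] f x

/-! ### The same operators on `L¹(a, b)` for a bounded interval -/

/-- The complex space `L¹(a, b)`. -/
abbrev L1 (a b : ℝ) := Lp ℂ 1 (volume.restrict (Ioo a b))

theorem interval_coe (a b : ℝ) : interval a b = Ioo a b := by
  ext x; simp [interval]

/-- Integration against a difference kernel, `∫_a^x f(y) k(x - y) dy`. -/
def volterra (a : ℝ) (k f : ℝ → ℂ) (x : ℝ) : ℂ := ∫ y in Ioo a x, f y * k (x - y)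

theorem volterra_aux {a b : ℝ} (k f : ℝ → ℂ) {x : ℝ} (hx : x ∈ Ioo a b) :
    (fun y => ContinuousLinearMap.mul ℂ ℂ ((Ioo a b).indicator f y)
      ((Ioo 0 (b - a)).indicator k (x - y))) =
    (Ioo a x).indicator (fun y => f y * k (x - y)) := by
  funext y
  obtain ⟨h1, h2⟩ := hx
  by_cases hy : y ∈ Ioo a x
  · have e1 : y ∈ Ioo a b := ⟨hy.1, hy.2.trans h2⟩
    have e2 : x - y ∈ Ioo 0 (b - a) := ⟨by linarith [hy.2], by linarith [hy.1]⟩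
    simp [hy, e1, e2]
  · rw [indicator_of_notMem hy]
    by_cases h : y ∈ Ioo a b
    · have e2 : x - y ∉ Ioo 0 (b - a) := fun h' => hy ⟨h.1, by linarith [h'.1]⟩
      simp [e2]
    · simp [h]

theorem volterra_eq {a b : ℝ} (k f : ℝ → ℂ) {x : ℝ} (hx : x ∈ Ioo a b) :
    volterra a k f x = MeasureTheory.convolution ((Ioo a b).indicator f)
      ((Ioo 0 (b - a)).indicator k) (ContinuousLinearMap.mul ℂ ℂ) volume x := by
  rw [MeasureTheory.convolution, volterra_aux k f hx, integral_indicator measurableSet_Ioo,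
    volterra]

theorem ae_integrableOn_volterra {a b : ℝ} {k f : ℝ → ℂ} (hk : IntegrableOn k (Ioo 0 (b - a)))
    (hf : IntegrableOn f (Ioo a b)) :
    ∀ᵐ x ∂(volume.restrict (Ioo a b)), IntegrableOn (fun y => f y * k (x - y)) (Ioo a x) := by
  rw [ae_restrict_iff' measurableSet_Ioo]
  filter_upwards [Integrable.ae_convolution_exists (ContinuousLinearMap.mul ℂ ℂ)
    (hf.integrable_indicator measurableSet_Ioo)
    (hk.integrable_indicator measurableSet_Ioo)] with x hx hxab
  rw [ConvolutionExistsAt, volterra_aux k f hxab] at hx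
  exact (integrable_indicator_iff measurableSet_Ioo).1 hx

theorem integrable_volterra {a b : ℝ} {k f : ℝ → ℂ} (hk : IntegrableOn k (Ioo 0 (b - a)))
    (hf : IntegrableOn f (Ioo a b)) :
    Integrable (volterra a k f) (volume.restrict (Ioo a b)) := by
  have h := Integrable.integrable_convolution (ContinuousLinearMap.mul ℂ ℂ)
    (hf.integrable_indicator measurableSet_Ioo) (hk.integrable_indicator measurableSet_Ioo)
  exact h.integrableOn.congr_fun (fun x hx => (volterra_eq k f hx).symm) measurableSet_Ioo

theorem integral_norm_volterra_le {a b : ℝ} {k f : ℝ → ℂ} (hk : IntegrableOn k (Ioo 0 (b - a)))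
    (hf : IntegrableOn f (Ioo a b)) :
    ∫ x in Ioo a b, ‖volterra a k f x‖ ≤
      (∫ x in Ioo 0 (b - a), ‖k x‖) * ∫ x in Ioo a b, ‖f x‖ := by
  have hF := hf.integrable_indicator measurableSet_Ioo
  have hK := hk.integrable_indicator measurableSet_Ioo
  have hc := Integrable.integrable_convolution (ContinuousLinearMap.mul ℂ ℂ) hF hK
  have hc' := Integrable.integrable_convolution (ContinuousLinearMap.mul ℝ ℝ) hF.norm hK.norm
  calc ∫ x in Ioo a b, ‖volterra a k f x‖
      = ∫ x in Ioo a b, ‖MeasureTheory.convolution ((Ioo a b).indicator f)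
          ((Ioo 0 (b - a)).indicator k) (ContinuousLinearMap.mul ℂ ℂ) volume x‖ :=
        setIntegral_congr_fun measurableSet_Ioo fun x hx => by
          simp only [volterra_eq k f hx]
    _ ≤ ∫ x, ‖MeasureTheory.convolution ((Ioo a b).indicator f)
          ((Ioo 0 (b - a)).indicator k) (ContinuousLinearMap.mul ℂ ℂ) volume x‖ :=
        setIntegral_le_integral hc.norm (Eventually.of_forall fun x => norm_nonneg _)
    _ ≤ ∫ x, MeasureTheory.convolution (fun x => ‖(Ioo a b).indicator f x‖)
          (fun x => ‖(Ioo 0 (b - a)).indicator k x‖) (ContinuousLinearMap.mul ℝ ℝ) volume x := by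
        refine integral_mono hc.norm hc' fun x => ?_
        refine (norm_integral_le_integral_norm _).trans (le_of_eq ?_)
        simp [MeasureTheory.convolution]
    _ = _ := by
        rw [integral_convolution _ hF.norm hK.norm, ContinuousLinearMap.mul_apply', mul_comm]
        simp only [norm_indicator_eq_indicator_norm]
        rw [integral_indicator measurableSet_Ioo, integral_indicator measurableSet_Ioo]

theorem integrableOn_coe {a b : ℝ} (f : L1 a b) : IntegrableOn (f : ℝ → ℂ) (Ioo a b) :=
  L1.integrable_coeFn f

/-- Two functions that agree almost everywhere on `(a, b)` have the same integrals. -/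
theorem volterra_congr {a b : ℝ} {k f g : ℝ → ℂ} (h : f =ᵐ[volume.restrict (Ioo a b)] g) {x : ℝ}
    (hx : x ∈ Ioo a b) : volterra a k f x = volterra a k g x := by
  refine integral_congr_ae ?_
  filter_upwards [ae_mono (Measure.restrict_mono (Ioo_subset_Ioo_right hx.2.le) le_rfl) h]
    with y hy
  rw [hy]

/-- `f ↦ ∫_a^x f(y) k(x - y) dy` as a bounded operator on `L¹(a, b)`. -/
def volterraOp (a b : ℝ) (k : ℝ → ℂ) (hk : IntegrableOn k (Ioo 0 (b - a))) :
    L1 a b →L[ℂ] L1 a b :=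
  LinearMap.mkContinuous
    { toFun := fun f => (integrable_volterra hk (integrableOn_coe f)).toL1 (volterra a k f)
      map_add' := fun f g => by
        rw [← Integrable.toL1_add, Integrable.toL1_eq_toL1_iff]
        filter_upwards [ae_integrableOn_volterra hk (integrableOn_coe f),
          ae_integrableOn_volterra hk (integrableOn_coe g),
          ae_restrict_mem measurableSet_Ioo] with x hf hg hx
        rw [volterra_congr (Lp.coeFn_add f g) hx, Pi.add_apply, volterra, volterra, volterra,
          ← integral_add hf hg]
        simp only [Pi.add_apply, add_mul]
      map_smul' := fun c f => by
        rw [RingHom.id_apply, ← Integrable.toL1_smul', Integrable.toL1_eq_toL1_iff]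
        filter_upwards [ae_restrict_mem measurableSet_Ioo] with x hx
        rw [volterra_congr (Lp.coeFn_smul c f) hx, Pi.smul_apply, volterra, volterra,
          ← integral_smul]
        simp only [Pi.smul_apply, smul_mul_assoc] }
    (∫ x in Ioo 0 (b - a), ‖k x‖) fun f => by
      rw [LinearMap.coe_mk, AddHom.coe_mk, L1.norm_eq_integral_norm, L1.norm_eq_integral_norm]
      refine le_trans (le_of_eq ?_) (integral_norm_volterra_le hk (integrableOn_coe f))
      refine integral_congr_ae ?_
      filter_upwards [Integrable.coeFn_toL1 (integrable_volterra hk (integrableOn_coe f))]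
        with x hx
      rw [hx]

theorem coeFn_volterraOp {a b : ℝ} {k : ℝ → ℂ} (hk : IntegrableOn k (Ioo 0 (b - a)))
    (f : L1 a b) : volterraOp a b k hk f =ᵐ[volume.restrict (Ioo a b)] volterra a k f :=
  Integrable.coeFn_toL1 (integrable_volterra hk (integrableOn_coe f))

/-- The kernel of the Riemann-Liouville integral. -/
def rlKernel (α : ℂ) (t : ℝ) : ℂ := (Complex.Gamma α)⁻¹ * (t : ℂ) ^ (α - 1)

theorem integrableOn_rlKernel {α : ℂ} (hα : 0 < α.re) (c : ℝ) :
    IntegrableOn (rlKernel α) (Ioo 0 c) := by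
  rcases le_or_gt c 0 with hc | hc
  · simp [Ioo_eq_empty_of_le hc]
  · have h := intervalIntegral.intervalIntegrable_cpow' (a := 0) (b := c) (r := α - 1)
      (by simp; linarith)
    rw [intervalIntegrable_iff_integrableOn_Ioo_of_le hc.le] at h
    exact h.const_mul _

/-- The integration operator `J : L¹(a, b) → L¹(a, b)`. -/
def integOp (a b : ℝ) : L1 a b →L[ℂ] L1 a b :=
  volterraOp a b (fun _ => 1) (integrableOn_const (by simp))

/-- The Riemann-Liouville operator of order `α` on `L¹(a, b)`, for `Re α > 0`. -/
def riemannLiouvilleOp (a b : ℝ) (α : ℂ) (hα : 0 < α.re) : L1 a b →L[ℂ] L1 a b :=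
  volterraOp a b (rlKernel α) (integrableOn_rlKernel hα _)

theorem coeFn_integOp {a b : ℝ} (f : L1 a b) :
    integOp a b f =ᵐ[volume.restrict (Ioo a b)] integ a f := by
  refine (coeFn_volterraOp _ f).trans (Eventually.of_forall fun x => ?_)
  simp [volterra, integ, interval_coe]

theorem coeFn_riemannLiouvilleOp {a b : ℝ} {α : ℂ} (hα : 0 < α.re) (f : L1 a b) :
    riemannLiouvilleOp a b α hα f =ᵐ[volume.restrict (Ioo a b)] riemannLiouville a α f := by
  refine (coeFn_volterraOp _ f).trans (Eventually.of_forall fun x => ?_)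
  simp only [volterra, riemannLiouville, interval_coe, rlKernel]
  rw [← integral_const_mul]
  congr 1
  funext y
  ring

end FracInt

end

/-!
Since `∑_{k ≤ n} P_k(n) (J/ρ)^k = (1 - J/ρ)^n`, the partial sums of the series are
`ρ^α ∑_{n < N} P_n(α) (1 - J/ρ)^n`. The operator `J^k` is convolution with `t^(k-1)/(k-1)!`, so up
to the multiple `ρ^α ∑_{n < N} P_n(α) → 0` of the identity such a partial sum is convolution with
the kernel `ρ^(α-1) ∑_{n < N} P_n(α) L_n'(t/ρ)`, where `L_n` is the Laguerre polynomial. The sum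
`y = ∑ P_n(α) L_n` solves `t y' = α y`, and `y = t^α/Γ(α+1)`, so these kernels tend to the
Riemann-Liouville kernel. An integrable bound uniform in `N` makes them converge in the weighted
space `L¹(e^(-ηt) dt)` for every `η > 1/ρ`, in which convolution is bounded.

Expanding the holomorphic functional calculus of `J + ε` around `ρ + ε` turns `(J + ε)^α` into
`(1 + ε/ρ)^α` times the Abel mean of the same series with ratio `ρ/(ρ + ε)`, so Abel's theorem gives
`(J + ε)^α → J^α`.
-/

noncomputable section

namespace FracInt

/-! ### The Newton coefficients -/

theorem pochhammerNewton_zero (α : ℂ) : pochhammerNewton 0 α = 1 := by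
  simp [pochhammerNewton]

theorem add_one_mul_pochhammerNewton_succ (n : ℕ) (α : ℂ) :
    (n + 1) * pochhammerNewton (n + 1) α = (n - α) * pochhammerNewton n α := by
  have hfact : (n.factorial : ℂ) ≠ 0 := by exact_mod_cast n.factorial_ne_zero
  have hsucc : (n : ℂ) + 1 ≠ 0 := by exact_mod_cast n.succ_ne_zero
  rw [pochhammerNewton, pochhammerNewton, Finset.prod_range_succ, Nat.factorial_succ]
  push_cast
  field_simp
  ring

theorem add_one_mul_choose_succ (α : ℂ) (n : ℕ) :
    (n + 1) * Ring.choose α (n + 1) = (α - n) * Ring.choose α n := by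
  have h := Ring.descPochhammer_eq_factorial_smul_choose α (n + 1)
  rw [descPochhammer_succ_right, Polynomial.smeval_mul,
    Ring.descPochhammer_eq_factorial_smul_choose α n, Nat.factorial_succ] at h
  simp only [Polynomial.smeval_sub, Polynomial.smeval_X, Polynomial.smeval_natCast,
    nsmul_eq_mul, pow_one, pow_zero, mul_one] at h
  push_cast at h
  have hfact : (n.factorial : ℂ) ≠ 0 := by exact_mod_cast n.factorial_ne_zero
  exact mul_left_cancel₀ hfact (by linear_combination -h)

theorem pochhammerNewton_eq_choose (n : ℕ) (α : ℂ) :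
    pochhammerNewton n α = (-1) ^ n * Ring.choose α n := by
  induction n with
  | zero => simp [pochhammerNewton]
  | succ n ih =>
    have hsucc : (n : ℂ) + 1 ≠ 0 := by exact_mod_cast n.succ_ne_zero
    apply mul_left_cancel₀ hsucc
    rw [add_one_mul_pochhammerNewton_succ, ih, pow_succ]
    linear_combination (-1) ^ n * add_one_mul_choose_succ α n

theorem pochhammerNewton_natCast (k n : ℕ) :
    pochhammerNewton k (n : ℂ) = (-1) ^ k * (n.choose k : ℂ) := by
  rw [pochhammerNewton_eq_choose, Ring.choose_natCast]

theorem sub_mul_pochhammerNewton_eq_inv_GammaSeq (α : ℂ) {n : ℕ} (hn : n ≠ 0) :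
    (n - α) * pochhammerNewton n α = (n : ℂ) ^ (-α) * (Complex.GammaSeq (-α) n)⁻¹ := by
  have hfact : (n.factorial : ℂ) ≠ 0 := by exact_mod_cast n.factorial_ne_zero
  have hpow : (n : ℂ) ^ (-α) ≠ 0 := by simp [Complex.cpow_eq_zero_iff, hn]
  have hprod : ∏ j ∈ Finset.range n, (-α + j) = (-1) ^ n * ∏ j ∈ Finset.range n, (α - j) := by
    simp only [neg_add_eq_sub, ← neg_sub α, Finset.prod_neg, Finset.card_range]
  rw [Complex.GammaSeq, Finset.prod_range_succ, hprod, pochhammerNewton, inv_div]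
  field_simp
  ring

theorem tendsto_inv_GammaSeq (s : ℂ) :
    Tendsto (fun n => (Complex.GammaSeq s n)⁻¹) atTop (𝓝 (Complex.Gamma s)⁻¹) := by
  by_cases hs : ∃ m : ℕ, s = -m
  · obtain ⟨m, rfl⟩ := hs
    rw [Complex.Gamma_neg_nat_eq_zero, inv_zero]
    refine tendsto_const_nhds.congr' ?_
    filter_upwards [eventually_ge_atTop m] with n hn
    rw [Complex.GammaSeq, Finset.prod_eq_zero (Finset.mem_range.2 (Nat.lt_succ_of_le hn))
      (neg_add_cancel _), div_zero, inv_zero]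
  · push Not at hs
    exact (Complex.GammaSeq_tendsto_Gamma s).inv₀ (Complex.Gamma_ne_zero hs)

theorem isBigO_pochhammerNewton (α : ℂ) :
    (fun n => pochhammerNewton n α) =O[atTop] fun n : ℕ => (n : ℝ) ^ (-(1 + α.re)) := by
  obtain ⟨B, hB⟩ := ((tendsto_inv_GammaSeq (-α)).isBigO_one ℝ).bound
  refine Asymptotics.IsBigO.of_bound (2 * B) ?_
  filter_upwards [hB, eventually_gt_atTop 0, eventually_ge_atTop ⌈2 * ‖α‖⌉₊] with n hGamma hn hnα
  have hn' : (0 : ℝ) < n := by exact_mod_cast hn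
  have hsub : (n : ℝ) / 2 ≤ ‖(n : ℂ) - α‖ := by
    have h := norm_sub_norm_le (n : ℂ) α
    rw [Complex.norm_natCast] at h
    linarith [Nat.ceil_le.1 hnα]
  have hnorm := congrArg norm (sub_mul_pochhammerNewton_eq_inv_GammaSeq α hn.ne')
  rw [norm_mul, norm_mul, Complex.norm_natCast_cpow_of_pos hn, Complex.neg_re] at hnorm
  rw [Real.norm_of_nonneg (by positivity), neg_add, Real.rpow_add hn', Real.rpow_neg_one]
  rw [norm_one, mul_one] at hGamma
  have hmul : (n : ℝ) / 2 * ‖pochhammerNewton n α‖ ≤ (n : ℝ) ^ (-α.re) * B :=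
    calc (n : ℝ) / 2 * ‖pochhammerNewton n α‖
        ≤ ‖(n : ℂ) - α‖ * ‖pochhammerNewton n α‖ := by gcongr
      _ = (n : ℝ) ^ (-α.re) * ‖(Complex.GammaSeq (-α) n)⁻¹‖ := hnorm
      _ ≤ (n : ℝ) ^ (-α.re) * B := by gcongr
  calc ‖pochhammerNewton n α‖ = 2 * (n : ℝ)⁻¹ * ((n : ℝ) / 2 * ‖pochhammerNewton n α‖) := by
        field_simp
    _ ≤ 2 * (n : ℝ)⁻¹ * ((n : ℝ) ^ (-α.re) * B) := by gcongr
    _ = 2 * B * ((n : ℝ)⁻¹ * (n : ℝ) ^ (-α.re)) := by ring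

theorem summable_norm_pochhammerNewton {α : ℂ} (hα : 0 < α.re) :
    Summable fun n => ‖pochhammerNewton n α‖ :=
  summable_of_isBigO_nat (Real.summable_nat_rpow.2 (by linarith))
    (isBigO_pochhammerNewton α).norm_left

theorem isBigO_natCast_mul_pochhammerNewton (α : ℂ) :
    (fun n : ℕ => n * pochhammerNewton n α) =O[atTop] fun n : ℕ => (n : ℝ) ^ (-α.re) := by
  have hcast : (fun n : ℕ => (n : ℂ)) =O[atTop] fun n : ℕ => (n : ℝ) :=
    Asymptotics.IsBigO.of_norm_left (by simpa using Asymptotics.isBigO_refl _ _)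
  refine (hcast.mul (isBigO_pochhammerNewton α)).congr' EventuallyEq.rfl ?_
  filter_upwards [eventually_gt_atTop 0] with n hn
  have hn' : (0 : ℝ) < n := by exact_mod_cast hn
  rw [neg_add, Real.rpow_add hn', Real.rpow_neg_one, mul_inv_cancel_left₀ hn'.ne']

theorem tendsto_natCast_mul_pochhammerNewton {α : ℂ} (hα : 0 < α.re) :
    Tendsto (fun n : ℕ => n * pochhammerNewton n α) atTop (𝓝 0) :=
  (isBigO_natCast_mul_pochhammerNewton α).trans_tendsto
    ((tendsto_rpow_neg_atTop hα).comp tendsto_natCast_atTop_atTop)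

theorem tsum_nat_add_rpow_le {s : ℝ} (hs : 0 < s) {N : ℕ} (hN : 0 < N) :
    ∑' n : ℕ, ((n + N : ℕ) : ℝ) ^ (-(1 + 2 * s)) ≤
      (∑' n : ℕ, (n : ℝ) ^ (-(1 + s))) * (N : ℝ) ^ (-s) := by
  have hN' : (0 : ℝ) < N := by exact_mod_cast hN
  have hsum : Summable fun n : ℕ => (n : ℝ) ^ (-(1 + s)) :=
    Real.summable_nat_rpow.2 (by linarith)
  have hsum' : Summable fun n : ℕ => (n : ℝ) ^ (-(1 + 2 * s)) :=
    Real.summable_nat_rpow.2 (by linarith)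
  rw [← tsum_mul_right]
  calc ∑' n : ℕ, ((n + N : ℕ) : ℝ) ^ (-(1 + 2 * s))
      ≤ ∑' n : ℕ, ((n + N : ℕ) : ℝ) ^ (-(1 + s)) * (N : ℝ) ^ (-s) := by
        refine ((summable_nat_add_iff N).2 hsum').tsum_le_tsum (fun n => ?_)
          (((summable_nat_add_iff N).2 hsum).mul_right _)
        have hpos : (0 : ℝ) < ((n + N : ℕ) : ℝ) := by exact_mod_cast Nat.add_pos_right n hN
        rw [show -(1 + 2 * s) = -(1 + s) + -s by ring, Real.rpow_add hpos]
        gcongr ?_ * ?_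
        exact Real.rpow_le_rpow_of_nonpos hN' (by simp) (by linarith)
    _ ≤ ∑' n : ℕ, (n : ℝ) ^ (-(1 + s)) * (N : ℝ) ^ (-s) := by
        rw [← (hsum.mul_right ((N : ℝ) ^ (-s))).sum_add_tsum_nat_add N]
        exact le_add_of_nonneg_left (Finset.sum_nonneg fun _ _ => by positivity)

theorem isBigO_tsum_norm_pochhammerNewton {α : ℂ} (hα : 0 < α.re) :
    (fun N => ∑' n, ‖pochhammerNewton (n + N) α‖) =O[atTop]
      fun N : ℕ => (N : ℝ) ^ (-(α.re / 2)) := by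
  obtain ⟨C, hC, hbound⟩ := Asymptotics.bound_of_isBigO_nat_atTop (isBigO_pochhammerNewton α)
  refine Asymptotics.IsBigO.of_bound (C * ∑' n : ℕ, (n : ℝ) ^ (-(1 + α.re / 2))) ?_
  filter_upwards [eventually_gt_atTop 0] with N hN
  rw [Real.norm_of_nonneg (tsum_nonneg fun _ => norm_nonneg _),
    Real.norm_of_nonneg (by positivity)]
  have hsum : Summable fun n : ℕ => (n : ℝ) ^ (-(1 + α.re)) :=
    Real.summable_nat_rpow.2 (by linarith)
  calc ∑' n, ‖pochhammerNewton (n + N) α‖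
      ≤ ∑' n : ℕ, C * ((n + N : ℕ) : ℝ) ^ (-(1 + α.re)) := by
        refine ((summable_nat_add_iff N).2 (summable_norm_pochhammerNewton hα)).tsum_le_tsum
          (fun n => ?_) (((summable_nat_add_iff N).2 hsum).mul_left C)
        have hpos : (0 : ℝ) < ((n + N : ℕ) : ℝ) := by exact_mod_cast Nat.add_pos_right n hN
        have h := hbound (x := n + N) (Real.rpow_pos_of_pos hpos _).ne'
        rwa [Real.norm_of_nonneg (by positivity)] at h
    _ = C * ∑' n : ℕ, ((n + N : ℕ) : ℝ) ^ (-(1 + 2 * (α.re / 2))) := by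
        rw [tsum_mul_left, mul_div_cancel₀ _ (two_ne_zero' ℝ)]
    _ ≤ C * ((∑' n : ℕ, (n : ℝ) ^ (-(1 + α.re / 2))) * (N : ℝ) ^ (-(α.re / 2))) := by
        gcongr
        exact tsum_nat_add_rpow_le (by positivity) hN
    _ = _ := by ring

/-! ### Laguerre polynomials -/

section Laguerre

open Polynomial

/-- The Laguerre polynomial `L_n`, normalized by `L_n(0) = 1`. -/
def laguerre (n : ℕ) : ℝ[X] :=
  ∑ k ∈ Finset.range (n + 1), monomial k ((-1) ^ k * (n.choose k : ℝ) / k.factorial)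

theorem coeff_laguerre (n k : ℕ) :
    (laguerre n).coeff k = (-1) ^ k * (n.choose k : ℝ) / k.factorial := by
  rw [laguerre, finsetSum_coeff]
  simp only [coeff_monomial, Finset.sum_ite_eq', Finset.mem_range]
  split_ifs with h
  · rfl
  · simp [Nat.choose_eq_zero_of_lt (by omega : n < k)]

theorem eval_laguerre (n : ℕ) (t : ℝ) : (laguerre n).eval t =
    ∑ k ∈ Finset.range (n + 1), (-1) ^ k * (n.choose k : ℝ) / k.factorial * t ^ k := by
  simp [laguerre, eval_finsetSum]

theorem laguerre_zero : laguerre 0 = 1 := by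
  simp [laguerre]

theorem eval_zero_laguerre (n : ℕ) : (laguerre n).eval 0 = 1 := by
  simp [← coeff_zero_eq_eval_zero, coeff_laguerre]

theorem eval_derivative_laguerre (n : ℕ) (t : ℝ) :
    (derivative (laguerre n)).eval t =
      ∑ k ∈ Finset.range n, (-1) ^ (k + 1) * (n.choose (k + 1) : ℝ) / k.factorial * t ^ k := by
  have hterm (k : ℕ) : (derivative (laguerre n)).coeff k =
      (-1) ^ (k + 1) * (n.choose (k + 1) : ℝ) / k.factorial := by
    rw [coeff_derivative, coeff_laguerre, Nat.factorial_succ]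
    push_cast
    field_simp
  have hdeg : (derivative (laguerre n)).natDegree < n + 1 :=
    Nat.lt_succ_of_le (natDegree_le_iff_coeff_eq_zero.2 fun k hk => by
      simp [hterm, Nat.choose_eq_zero_of_lt (Nat.lt_succ_of_lt hk)])
  rw [eval_eq_sum_range' hdeg, Finset.sum_range_succ]
  simp [hterm]

theorem X_mul_derivative_laguerre_succ (n : ℕ) :
    X * derivative (laguerre (n + 1)) = C (n + 1 : ℝ) * (laguerre (n + 1) - laguerre n) := by
  ext k
  rcases k with _ | k
  · simp [coeff_laguerre]
  · rw [coeff_X_mul, coeff_derivative, coeff_C_mul, coeff_sub, coeff_laguerre, coeff_laguerre]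
    have hpascal : ((n + 1).choose (k + 1) : ℝ) = n.choose k + n.choose (k + 1) := by
      exact_mod_cast Nat.choose_succ_succ n k
    have habsorb : ((n : ℝ) + 1) * n.choose k = (n + 1).choose (k + 1) * (k + 1) := by
      exact_mod_cast Nat.add_one_mul_choose_eq n k
    rw [eq_sub_of_add_eq' hpascal.symm]
    field_simp
    linarith

theorem derivative_laguerre_succ (n : ℕ) :
    derivative (laguerre (n + 1)) = derivative (laguerre n) - laguerre n := by
  ext k
  rw [coeff_derivative, coeff_sub, coeff_derivative, coeff_laguerre, coeff_laguerre,
    coeff_laguerre, Nat.choose_succ_succ, Nat.factorial_succ]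
  push_cast
  field_simp
  ring

theorem laguerre_differential_equation (n : ℕ) :
    X * derivative (derivative (laguerre n)) + (1 - X) * derivative (laguerre n) +
      C (n : ℝ) * laguerre n = 0 := by
  rcases n with _ | n
  · simp [laguerre_zero]
  · have hderiv := congrArg derivative (X_mul_derivative_laguerre_succ n)
    rw [derivative_mul, derivative_C_mul, derivative_sub, derivative_X] at hderiv
    push_cast
    linear_combination hderiv - X_mul_derivative_laguerre_succ n +
      C (n + 1 : ℝ) * derivative_laguerre_succ n

/-- The energy `e^{-2t} (n L_n(t)² + t L_n'(t)²)`, which decreases on the whole line. -/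
def laguerreEnergy (n : ℕ) (t : ℝ) : ℝ :=
  Real.exp (-2 * t) * (n * (laguerre n).eval t ^ 2 + t * (derivative (laguerre n)).eval t ^ 2)

theorem hasDerivAt_laguerreEnergy (n : ℕ) (t : ℝ) :
    HasDerivAt (laguerreEnergy n) (-Real.exp (-2 * t) *
      ((derivative (laguerre n)).eval t ^ 2 + 2 * n * (laguerre n).eval t ^ 2)) t := by
  have hexp : HasDerivAt (fun t : ℝ => Real.exp (-2 * t)) (Real.exp (-2 * t) * (-2 * 1)) t :=
    ((hasDerivAt_id t).const_mul (-2)).exp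
  refine (hexp.mul (((((laguerre n).hasDerivAt t).pow 2).const_mul (n : ℝ)).add
    ((hasDerivAt_id t).mul
      (((derivative (laguerre n)).hasDerivAt t).pow 2)))).congr_deriv ?_
  have hode := congrArg (eval t) (laguerre_differential_equation n)
  simp only [eval_add, eval_mul, eval_X, eval_C, eval_sub, eval_one, eval_zero] at hode
  simp only [id, Pi.pow_apply, Pi.mul_apply, Pi.add_apply]
  push_cast
  linear_combination 2 * Real.exp (-2 * t) * (derivative (laguerre n)).eval t * hode

theorem antitone_laguerreEnergy (n : ℕ) : Antitone (laguerreEnergy n) :=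
  antitone_of_hasDerivAt_nonpos (hasDerivAt_laguerreEnergy n) fun t => by
    rw [neg_mul, Pi.zero_apply, Left.neg_nonpos_iff]
    positivity

theorem laguerre_energy_le (n : ℕ) {t : ℝ} (ht : 0 ≤ t) :
    n * (laguerre n).eval t ^ 2 + t * (derivative (laguerre n)).eval t ^ 2 ≤
      n * Real.exp t ^ 2 := by
  have hexp : Real.exp t ^ 2 * Real.exp (-2 * t) = 1 := by
    rw [← Real.exp_nat_mul, ← Real.exp_add]
    simp
  have hle : laguerreEnergy n t ≤ n := by
    simpa [laguerreEnergy, eval_zero_laguerre] using antitone_laguerreEnergy n ht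
  calc n * (laguerre n).eval t ^ 2 + t * (derivative (laguerre n)).eval t ^ 2
      = Real.exp t ^ 2 * laguerreEnergy n t := by
        rw [laguerreEnergy, ← mul_assoc, hexp, one_mul]
    _ ≤ Real.exp t ^ 2 * n := by gcongr
    _ = n * Real.exp t ^ 2 := mul_comm _ _

theorem abs_eval_laguerre_le (n : ℕ) {t : ℝ} (ht : 0 ≤ t) :
    |(laguerre n).eval t| ≤ Real.exp t := by
  rcases n.eq_zero_or_pos with rfl | hn
  · simpa [laguerre_zero] using ht
  · have hn' : (0 : ℝ) < n := by exact_mod_cast hn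
    have hnonneg : 0 ≤ t * (derivative (laguerre n)).eval t ^ 2 := by positivity
    refine abs_le_of_sq_le_sq ?_ (Real.exp_pos t).le
    exact le_of_mul_le_mul_left (by linarith [laguerre_energy_le n ht]) hn'

theorem abs_eval_derivative_laguerre_le (n : ℕ) {t : ℝ} (ht : 0 < t) :
    |(derivative (laguerre n)).eval t| ≤ √n * Real.exp t * t ^ (-(1 / 2) : ℝ) := by
  have hsq : (t ^ (-(1 / 2) : ℝ)) ^ 2 = t⁻¹ := by
    rw [← Real.rpow_natCast, ← Real.rpow_mul ht.le, ← Real.rpow_neg_one]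
    norm_num
  have hnonneg : 0 ≤ (n : ℝ) * (laguerre n).eval t ^ 2 := by positivity
  refine abs_le_of_sq_le_sq ?_ (by positivity)
  rw [mul_pow, mul_pow, Real.sq_sqrt (Nat.cast_nonneg n), hsq, ← div_eq_mul_inv, le_div_iff₀ ht]
  linarith [laguerre_energy_le n ht.le]

theorem integral_exp_neg_mul_mul_pow {s : ℝ} (hs : 0 < s) (k : ℕ) :
    ∫ t in Ioi (0 : ℝ), Real.exp (-(s * t)) * t ^ k = k.factorial * s⁻¹ ^ (k + 1) := by
  have h := Real.integral_rpow_mul_exp_neg_mul_Ioi (a := k + 1) (r := s) (by positivity) hs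
  rw [Real.Gamma_nat_eq_factorial, one_div, mul_comm] at h
  rw [← Real.rpow_natCast, Nat.cast_succ, ← h]
  refine setIntegral_congr_fun measurableSet_Ioi fun t _ => ?_
  simp only [add_sub_cancel_right, Real.rpow_natCast]
  ring

theorem integral_exp_neg_mul_mul_laguerre {s : ℝ} (hs : 0 < s) (n : ℕ) :
    ∫ t in Ioi (0 : ℝ), Real.exp (-(s * t)) * (laguerre n).eval t = (1 - s⁻¹) ^ n * s⁻¹ := by
  have hint (k : ℕ) : IntegrableOn (fun t : ℝ => Real.exp (-(s * t)) * t ^ k) (Ioi 0) := by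
    refine Integrable.of_integral_ne_zero ?_
    rw [integral_exp_neg_mul_mul_pow hs]
    positivity
  have hexpand (t : ℝ) : Real.exp (-(s * t)) * (laguerre n).eval t =
      ∑ k ∈ Finset.range (n + 1), (-1) ^ k * (n.choose k : ℝ) / k.factorial *
        (Real.exp (-(s * t)) * t ^ k) := by
    rw [eval_laguerre, Finset.mul_sum]
    exact Finset.sum_congr rfl fun k _ => by ring
  simp only [hexpand]
  rw [integral_finsetSum _ fun k _ => (hint k).const_mul _, sub_eq_neg_add, add_pow,
    Finset.sum_mul]
  refine Finset.sum_congr rfl fun k _ => ?_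
  rw [integral_const_mul, integral_exp_neg_mul_mul_pow hs, neg_pow s⁻¹, one_pow, pow_succ]
  field_simp

end Laguerre

/-- The partial sums of the Newton-Laguerre series `∑_n P_n(α) L_n(t)`, which expands
`t^α / Γ(α + 1)`. -/
def newtonLaguerre (α : ℂ) (N : ℕ) (t : ℝ) : ℂ :=
  ∑ n ∈ Finset.range N, pochhammerNewton n α * ((laguerre n).eval t : ℝ)

/-- The derivatives `∑_{n < N} P_n(α) L_n'(t)` of the partial sums of the Newton-Laguerre
series. -/
def newtonLaguerreDeriv (α : ℂ) (N : ℕ) (t : ℝ) : ℂ :=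
  ∑ n ∈ Finset.range N, pochhammerNewton n α * ((Polynomial.derivative (laguerre n)).eval t : ℝ)

/-- The sum of the Newton-Laguerre series `∑_n P_n(α) L_n(t)`. -/
def newtonLaguerreSum (α : ℂ) (t : ℝ) : ℂ :=
  ∑' n, pochhammerNewton n α * ((laguerre n).eval t : ℝ)

theorem hasDerivAt_newtonLaguerre (α : ℂ) (N : ℕ) (t : ℝ) :
    HasDerivAt (newtonLaguerre α N) (newtonLaguerreDeriv α N t) t :=
  HasDerivAt.fun_sum fun n _ => ((laguerre n).hasDerivAt t).ofReal_comp.const_mul _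

/-- Multiplication by `t` turns the derivative into the telescoping sum of
`n P_n(α) (L_n - L_{n-1})`, so the partial sums nearly solve `t y' = α y`. -/
theorem mul_newtonLaguerreDeriv (α : ℂ) (N : ℕ) (t : ℝ) :
    t * newtonLaguerreDeriv α (N + 1) t = α * newtonLaguerre α (N + 1) t +
      (N + 1 : ℕ) * pochhammerNewton (N + 1) α * ((laguerre N).eval t : ℝ) := by
  induction N with
  | zero =>
    have hP := add_one_mul_pochhammerNewton_succ 0 α
    simp only [pochhammerNewton_zero, Nat.cast_zero, zero_add, one_mul, zero_sub, mul_one] at hP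
    simp [newtonLaguerreDeriv, newtonLaguerre, laguerre_zero, pochhammerNewton_zero, hP]
  | succ N ih =>
    have hL := congrArg (fun p : Polynomial ℝ => ((p.eval t : ℝ) : ℂ))
      (X_mul_derivative_laguerre_succ N)
    simp only [Polynomial.eval_mul, Polynomial.eval_X, Polynomial.eval_C,
      Polynomial.eval_sub] at hL
    have hP := add_one_mul_pochhammerNewton_succ (N + 1) α
    rw [newtonLaguerreDeriv, Finset.sum_range_succ, ← newtonLaguerreDeriv, newtonLaguerre,
      Finset.sum_range_succ, ← newtonLaguerre]
    push_cast at hL hP ih ⊢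
    linear_combination ih + pochhammerNewton (N + 1) α * hL -
      ((laguerre (N + 1)).eval t : ℝ) * hP

theorem sum_pochhammerNewton (α : ℂ) (N : ℕ) :
    α * ∑ n ∈ Finset.range (N + 1), pochhammerNewton n α =
      -((N + 1 : ℕ) * pochhammerNewton (N + 1) α) := by
  have h := mul_newtonLaguerreDeriv α N 0
  simp only [newtonLaguerre, eval_zero_laguerre, Complex.ofReal_zero, zero_mul,
    Complex.ofReal_one, mul_one] at h
  linear_combination -h

theorem tendsto_sum_pochhammerNewton {α : ℂ} (hα : 0 < α.re) :
    Tendsto (fun N => ∑ n ∈ Finset.range N, pochhammerNewton n α) atTop (𝓝 0) := by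
  have hα0 : α ≠ 0 := fun h => by simp [h] at hα
  rw [← tendsto_add_atTop_iff_nat 1]
  have h := ((tendsto_add_atTop_iff_nat 1).2
    (tendsto_natCast_mul_pochhammerNewton hα)).const_mul (-α⁻¹)
  rw [mul_zero] at h
  refine h.congr fun N => ?_
  rw [neg_mul, ← mul_neg, ← sum_pochhammerNewton, inv_mul_cancel_left₀ hα0]

theorem norm_pochhammerNewton_mul_laguerre_le (m n : ℕ) (α : ℂ) {t : ℝ} (ht : 0 ≤ t) :
    ‖pochhammerNewton m α * ((laguerre n).eval t : ℝ)‖ ≤ ‖pochhammerNewton m α‖ * Real.exp t := by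
  rw [norm_mul, Complex.norm_real]
  exact mul_le_mul_of_nonneg_left (abs_eval_laguerre_le n ht) (norm_nonneg _)

theorem summable_norm_newtonLaguerre {α : ℂ} (hα : 0 < α.re) {t : ℝ} (ht : 0 ≤ t) :
    Summable fun n => ‖pochhammerNewton n α * ((laguerre n).eval t : ℝ)‖ :=
  Summable.of_nonneg_of_le (fun _ => norm_nonneg _)
    (fun n => norm_pochhammerNewton_mul_laguerre_le n n α ht)
    ((summable_norm_pochhammerNewton hα).mul_right (Real.exp t))

theorem tendsto_newtonLaguerre {α : ℂ} (hα : 0 < α.re) {t : ℝ} (ht : 0 ≤ t) :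
    Tendsto (fun N => newtonLaguerre α N t) atTop (𝓝 (newtonLaguerreSum α t)) :=
  (summable_norm_newtonLaguerre hα ht).of_norm.hasSum.tendsto_sum_nat

theorem norm_newtonLaguerre_sub_le {α : ℂ} (hα : 0 < α.re) {t : ℝ} (ht : 0 ≤ t) (N : ℕ) :
    ‖newtonLaguerre α N t - newtonLaguerreSum α t‖ ≤
      (∑' n, ‖pochhammerNewton (n + N) α‖) * Real.exp t := by
  have hs := summable_norm_newtonLaguerre hα ht
  have htail := (summable_nat_add_iff N).2 hs
  rw [newtonLaguerreSum, ← hs.of_norm.sum_add_tsum_nat_add N, newtonLaguerre, sub_add_cancel_left,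
    norm_neg, ← tsum_mul_right]
  exact (norm_tsum_le_tsum_norm htail).trans (htail.tsum_le_tsum
    (fun n => norm_pochhammerNewton_mul_laguerre_le _ _ α ht)
    (((summable_nat_add_iff N).2 (summable_norm_pochhammerNewton hα)).mul_right _))

theorem hasDerivAt_cpow_mul_newtonLaguerre (α : ℂ) (N : ℕ) {t : ℝ} (ht : 0 < t) :
    HasDerivAt (fun t : ℝ => (t : ℂ) ^ (-α) * newtonLaguerre α (N + 1) t)
      ((N + 1 : ℕ) * pochhammerNewton (N + 1) α * (t : ℂ) ^ (-α - 1) *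
        ((laguerre N).eval t : ℝ)) t := by
  have ht' : (t : ℂ) ≠ 0 := by exact_mod_cast ht.ne'
  have hpow : HasDerivAt (fun t : ℝ => (t : ℂ) ^ (-α)) (-α * (t : ℂ) ^ (-α - 1) * 1) t :=
    ((hasDerivAt_id (t : ℂ)).cpow_const (Or.inl (by simpa using ht))).comp_ofReal
  refine (hpow.mul (hasDerivAt_newtonLaguerre α (N + 1) t)).congr_deriv ?_
  have hsplit : (t : ℂ) ^ (-α) = (t : ℂ) ^ (-α - 1) * t := by
    rw [Complex.cpow_sub _ _ ht', Complex.cpow_one, div_mul_cancel₀ _ ht']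
  rw [hsplit]
  linear_combination (t : ℂ) ^ (-α - 1) * mul_newtonLaguerreDeriv α N t

theorem norm_cpow_mul_newtonLaguerre_sub_le {α : ℂ} (hα : -1 ≤ α.re) (N : ℕ) {t : ℝ}
    (ht : 0 < t) :
    ‖(t : ℂ) ^ (-α) * newtonLaguerre α (N + 1) t - newtonLaguerre α (N + 1) 1‖ ≤
      ‖(N + 1 : ℕ) * pochhammerNewton (N + 1) α‖ *
        (min 1 t ^ (-α.re - 1) * Real.exp (max 1 t)) * ‖t - 1‖ := by
  have hmin : 0 < min 1 t := lt_min one_pos ht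
  have h := Convex.norm_image_sub_le_of_norm_hasDerivWithin_le (s := uIcc 1 t)
    (C := ‖((N + 1 : ℕ) : ℂ) * pochhammerNewton (N + 1) α‖ *
      (min 1 t ^ (-α.re - 1) * Real.exp (max 1 t)))
    (fun s hs => (hasDerivAt_cpow_mul_newtonLaguerre α N
      (hmin.trans_le hs.1)).hasDerivWithinAt) (fun s hs => ?_) (convex_uIcc 1 t)
    left_mem_uIcc right_mem_uIcc
  · simpa using h
  have hs0 : 0 < s := hmin.trans_le hs.1
  rw [norm_mul, norm_mul, mul_assoc, Complex.norm_cpow_eq_rpow_re_of_pos hs0, Complex.norm_real]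
  refine mul_le_mul_of_nonneg_left (mul_le_mul ?_ ((abs_eval_laguerre_le N hs0.le).trans
    (Real.exp_le_exp.2 hs.2)) (norm_nonneg _) (by positivity)) (norm_nonneg _)
  simp only [Complex.sub_re, Complex.neg_re, Complex.one_re]
  exact Real.rpow_le_rpow_of_nonpos hmin hs.1 (by linarith)

theorem newtonLaguerreSum_eq_mul_cpow {α : ℂ} (hα : 0 < α.re) {t : ℝ} (ht : 0 < t) :
    newtonLaguerreSum α t = newtonLaguerreSum α 1 * (t : ℂ) ^ α := by
  have hcpow : (t : ℂ) ^ α ≠ 0 := by simp [Complex.cpow_eq_zero_iff, ht.ne']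
  have hlim : Tendsto (fun N => (t : ℂ) ^ (-α) * newtonLaguerre α (N + 1) t -
      newtonLaguerre α (N + 1) 1) atTop
      (𝓝 ((t : ℂ) ^ (-α) * newtonLaguerreSum α t - newtonLaguerreSum α 1)) :=
    (((tendsto_newtonLaguerre hα ht.le).comp (tendsto_add_atTop_nat 1)).const_mul _).sub
      ((tendsto_newtonLaguerre hα zero_le_one).comp (tendsto_add_atTop_nat 1))
  have hzero : Tendsto (fun N => (t : ℂ) ^ (-α) * newtonLaguerre α (N + 1) t -
      newtonLaguerre α (N + 1) 1) atTop (𝓝 0) := by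
    refine squeeze_zero_norm
      (fun N => norm_cpow_mul_newtonLaguerre_sub_le (by linarith) N ht) ?_
    simpa using (((tendsto_natCast_mul_pochhammerNewton hα).comp
      (tendsto_add_atTop_nat 1)).norm.mul_const _).mul_const _
  rw [← sub_eq_zero.1 (tendsto_nhds_unique hlim hzero), Complex.cpow_neg]
  field_simp

theorem hasSum_pochhammerNewton_mul_pow (α : ℂ) {z : ℂ} (hz : ‖z‖ < 1) :
    HasSum (fun n => pochhammerNewton n α * z ^ n) ((1 - z) ^ α) := by
  have h := (Complex.one_add_cpow_hasFPowerSeriesOnBall_zero (a := α)).hasSum (y := -z)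
    (by simpa [← ENNReal.ofReal_one, Metric.eball_ofReal] using hz)
  simp only [binomialSeries_apply, List.ofFn_const, List.prod_replicate, zero_add,
    smul_eq_mul] at h
  rw [← sub_eq_add_neg] at h
  refine h.congr_fun fun n => ?_
  rw [pochhammerNewton_eq_choose, neg_pow z]
  ring

theorem norm_exp_mul_pochhammerNewton_mul_laguerre_le (n : ℕ) (α : ℂ) {t : ℝ} (ht : 0 ≤ t) :
    ‖Complex.exp (-(2 * t)) * (pochhammerNewton n α * ((laguerre n).eval t : ℝ))‖ ≤
      ‖pochhammerNewton n α‖ * Real.exp (-t) := by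
  have hexp : ‖Complex.exp (-(2 * t))‖ = Real.exp (-(2 * t)) := by simp [Complex.norm_exp]
  calc _ ≤ Real.exp (-(2 * t)) * (‖pochhammerNewton n α‖ * Real.exp t) := by
        rw [norm_mul, hexp]
        gcongr
        exact norm_pochhammerNewton_mul_laguerre_le n n α ht
    _ = ‖pochhammerNewton n α‖ * Real.exp (-t) := by
        rw [mul_left_comm, ← Real.exp_add]
        ring_nf

theorem integrableOn_exp_mul_pochhammerNewton_mul_laguerre (n : ℕ) (α : ℂ) :
    IntegrableOn (fun t : ℝ => Complex.exp (-(2 * t)) *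
      (pochhammerNewton n α * ((laguerre n).eval t : ℝ))) (Ioi 0) :=
  ((integrableOn_exp_neg_Ioi 0).const_mul ‖pochhammerNewton n α‖).mono'
    (Continuous.aestronglyMeasurable (by fun_prop)) ((ae_restrict_mem measurableSet_Ioi).mono
      fun _ ht => norm_exp_mul_pochhammerNewton_mul_laguerre_le n α (le_of_lt ht))

theorem integral_norm_exp_mul_pochhammerNewton_mul_laguerre_le (n : ℕ) (α : ℂ) :
    ∫ t in Ioi (0 : ℝ), ‖Complex.exp (-(2 * t)) *
      (pochhammerNewton n α * ((laguerre n).eval t : ℝ))‖ ≤ ‖pochhammerNewton n α‖ := by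
  refine (setIntegral_mono_on (integrableOn_exp_mul_pochhammerNewton_mul_laguerre n α).norm
    ((integrableOn_exp_neg_Ioi 0).const_mul _) measurableSet_Ioi fun t ht =>
      norm_exp_mul_pochhammerNewton_mul_laguerre_le n α (le_of_lt ht)).trans_eq ?_
  rw [integral_const_mul, integral_exp_neg_Ioi_zero, mul_one]

theorem integral_exp_mul_newtonLaguerreSum {α : ℂ} (hα : 0 < α.re) :
    ∫ t in Ioi (0 : ℝ), Complex.exp (-(2 * t)) * newtonLaguerreSum α t =
      (1 / 2 : ℂ) ^ (α + 1) := by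
  have hswap := hasSum_integral_of_summable_integral_norm
    (fun n => integrableOn_exp_mul_pochhammerNewton_mul_laguerre n α)
    ((summable_norm_pochhammerNewton hα).of_nonneg_of_le
      (fun n => integral_nonneg fun _ => norm_nonneg _)
      fun n => integral_norm_exp_mul_pochhammerNewton_mul_laguerre_le n α)
  have hterm (n : ℕ) : ∫ t in Ioi (0 : ℝ), Complex.exp (-(2 * t)) *
      (pochhammerNewton n α * ((laguerre n).eval t : ℝ)) =
        pochhammerNewton n α * (1 / 2) ^ n * (1 / 2) := by
    have h := congrArg (fun x : ℝ => (x : ℂ)) (integral_exp_neg_mul_mul_laguerre two_pos n)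
    rw [← integral_complex_ofReal] at h
    push_cast at h
    rw [mul_assoc, show (1 / 2 : ℂ) ^ n * (1 / 2) = (1 - 2⁻¹) ^ n * 2⁻¹ by norm_num, ← h,
      ← integral_const_mul]
    simp only [mul_left_comm]
  simp only [hterm, tsum_mul_left] at hswap
  simp only [newtonLaguerreSum]
  rw [hswap.unique ((hasSum_pochhammerNewton_mul_pow α (by norm_num)).mul_right _),
    Complex.cpow_add _ _ (by norm_num), Complex.cpow_one]
  norm_num

/-- The constant is read off from the Laplace transforms at `2`. -/
theorem newtonLaguerreSum_eq {α : ℂ} (hα : 0 < α.re) {t : ℝ} (ht : 0 < t) :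
    newtonLaguerreSum α t = (Complex.Gamma (α + 1))⁻¹ * (t : ℂ) ^ α := by
  have hhalf : (1 / 2 : ℂ) ^ (α + 1) ≠ 0 := by simp [Complex.cpow_eq_zero_iff]
  have hlaplace := Complex.integral_cpow_mul_exp_neg_mul_Ioi (a := α + 1) (r := 2)
    (by simp; linarith) (by simp)
  have hconst : newtonLaguerreSum α 1 * ((1 / 2) ^ (α + 1) * Complex.Gamma (α + 1)) =
      (1 / 2 : ℂ) ^ (α + 1) := by
    rw [Complex.ofReal_ofNat] at hlaplace
    rw [← hlaplace, ← integral_const_mul, ← integral_exp_mul_newtonLaguerreSum hα]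
    refine setIntegral_congr_fun measurableSet_Ioi fun s hs => ?_
    simp only [add_sub_cancel_right]
    rw [newtonLaguerreSum_eq_mul_cpow hα hs]
    ring
  rw [newtonLaguerreSum_eq_mul_cpow hα ht]
  congr 1
  exact eq_inv_of_mul_eq_one_left (mul_left_cancel₀ hhalf (by linear_combination hconst))

/-! ### Exponentially weighted convolution -/

/-- The convolution of two complex-valued functions on the line. -/
abbrev cconv (f k : ℝ → ℂ) : ℝ → ℂ :=
  MeasureTheory.convolution f k (ContinuousLinearMap.mul ℂ ℂ) volume

/-- Absolute convergence of the integral that defines `cconv f k x`. -/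
abbrev CConvExistsAt (f k : ℝ → ℂ) (x : ℝ) : Prop :=
  ConvolutionExistsAt f k x (ContinuousLinearMap.mul ℂ ℂ) volume

/-- The function `x ↦ e^(-ηx) f(x)`. Since `e^(-ηx) = e^(-ηy) e^(-η(x - y))`, this weighting
commutes with convolution. -/
def expWeight (η : ℝ) (f : ℝ → ℂ) (x : ℝ) : ℂ := Real.exp (-(η * x)) • f x

/-- Integrability with respect to the weight `e^(-ηx)`. -/
def ExpIntegrable (η : ℝ) (f : ℝ → ℂ) : Prop := Integrable (expWeight η f)

/-- The norm of the weighted space `L¹(e^(-ηx) dx)`. -/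
def expNorm (η : ℝ) (f : ℝ → ℂ) : ℝ := ∫ x, ‖expWeight η f x‖

section Weight

variable {η : ℝ} {f g k : ℝ → ℂ} {x : ℝ}

theorem norm_expWeight (η : ℝ) (f : ℝ → ℂ) (x : ℝ) :
    ‖expWeight η f x‖ = Real.exp (-(η * x)) * ‖f x‖ := by
  rw [expWeight, norm_smul, Real.norm_eq_abs, Real.abs_exp]

theorem expWeight_neg_expWeight (η : ℝ) (f : ℝ → ℂ) : expWeight (-η) (expWeight η f) = f := by
  funext x
  rw [expWeight, expWeight, smul_smul, ← Real.exp_add]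
  simp

theorem aestronglyMeasurable_expWeight (η : ℝ) (hf : AEStronglyMeasurable f) :
    AEStronglyMeasurable (expWeight η f) :=
  (by fun_prop : Continuous fun x : ℝ => Real.exp (-(η * x))).aestronglyMeasurable.smul hf

theorem ExpIntegrable.aestronglyMeasurable (hf : ExpIntegrable η f) : AEStronglyMeasurable f := by
  rw [← expWeight_neg_expWeight η f]
  exact aestronglyMeasurable_expWeight (-η) (Integrable.aestronglyMeasurable hf)

theorem expWeight_mul_expWeight (η : ℝ) (f k : ℝ → ℂ) (x y : ℝ) :
    ContinuousLinearMap.mul ℂ ℂ (expWeight η f y) (expWeight η k (x - y)) =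
      Real.exp (-(η * x)) • ContinuousLinearMap.mul ℂ ℂ (f y) (k (x - y)) := by
  have hexp : Real.exp (-(η * x)) = Real.exp (-(η * y)) * Real.exp (-(η * (x - y))) := by
    rw [← Real.exp_add]
    ring_nf
  simp only [expWeight, Complex.real_smul, ContinuousLinearMap.mul_apply', hexp]
  push_cast
  ring

theorem cconv_expWeight (η : ℝ) (f k : ℝ → ℂ) :
    cconv (expWeight η f) (expWeight η k) = expWeight η (cconv f k) := by
  funext x
  simp only [cconv, MeasureTheory.convolution, expWeight_mul_expWeight]
  exact integral_smul _ _

theorem cconvExistsAt_expWeight :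
    CConvExistsAt (expWeight η f) (expWeight η k) x ↔ CConvExistsAt f k x := by
  simp only [CConvExistsAt, ConvolutionExistsAt, expWeight_mul_expWeight]
  exact integrable_smul_iff (Real.exp_pos _).ne' _

theorem ExpIntegrable.ae_cconvExistsAt (hf : ExpIntegrable η f) (hk : ExpIntegrable η k) :
    ∀ᵐ x, CConvExistsAt f k x := by
  filter_upwards [Integrable.ae_convolution_exists (ContinuousLinearMap.mul ℂ ℂ) hf hk] with x hx
  exact cconvExistsAt_expWeight.1 hx

theorem ExpIntegrable.convolution (hf : ExpIntegrable η f) (hk : ExpIntegrable η k) :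
    ExpIntegrable η (cconv f k) := by
  rw [ExpIntegrable, ← cconv_expWeight]
  exact Integrable.integrable_convolution (ContinuousLinearMap.mul ℂ ℂ) hf hk

theorem expNorm_cconv_le (hf : ExpIntegrable η f) (hk : ExpIntegrable η k) :
    expNorm η (cconv f k) ≤ expNorm η f * expNorm η k := by
  rw [expNorm, ← cconv_expWeight]
  calc ∫ x, ‖cconv (expWeight η f) (expWeight η k) x‖
      ≤ ∫ x, MeasureTheory.convolution (fun x => ‖expWeight η f x‖)
          (fun x => ‖expWeight η k x‖) (ContinuousLinearMap.mul ℝ ℝ) volume x := by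
        refine integral_mono
          (Integrable.integrable_convolution (ContinuousLinearMap.mul ℂ ℂ) hf hk).norm
          (Integrable.integrable_convolution (ContinuousLinearMap.mul ℝ ℝ)
            (Integrable.norm hf) (Integrable.norm hk)) fun x => ?_
        refine (norm_integral_le_integral_norm _).trans (le_of_eq ?_)
        simp [MeasureTheory.convolution]
    _ = expNorm η f * expNorm η k :=
        integral_convolution _ (Integrable.norm hf) (Integrable.norm hk)

theorem ae_cconv_assoc_of_integrable (hf : Integrable f) (hg : Integrable g)
    (hk : Integrable k) : ∀ᵐ x, cconv (cconv f g) k x = cconv f (cconv g k) x := by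
  filter_upwards [Integrable.ae_convolution_exists (ContinuousLinearMap.mul ℝ ℝ) hf.norm
    (Integrable.integrable_convolution (ContinuousLinearMap.mul ℝ ℝ) hg.norm hk.norm)] with x hx
  exact convolution_assoc _ _ _ _ (fun a b c => by simp [mul_assoc]) hf.aestronglyMeasurable
    hg.aestronglyMeasurable hk.aestronglyMeasurable
    (Integrable.ae_convolution_exists (ContinuousLinearMap.mul ℂ ℂ) hf hg)
    (Integrable.ae_convolution_exists (ContinuousLinearMap.mul ℝ ℝ) hg.norm hk.norm) hx

theorem ExpIntegrable.ae_cconv_assoc (hf : ExpIntegrable η f) (hg : ExpIntegrable η g)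
    (hk : ExpIntegrable η k) :
    ∀ᵐ x, cconv (cconv f g) k x = cconv f (cconv g k) x := by
  filter_upwards [ae_cconv_assoc_of_integrable hf hg hk] with x hx
  simp only [cconv_expWeight] at hx
  rw [expWeight, expWeight] at hx
  exact smul_right_injective ℂ (Real.exp_pos _).ne' hx

theorem cconv_const_smul_right (c : ℂ) (f k : ℝ → ℂ) (x : ℝ) :
    cconv f (c • k) x = c * cconv f k x := by
  simp only [cconv, convolution_smul, Pi.smul_apply, smul_eq_mul]

theorem CConvExistsAt.const_smul (c : ℂ) (h : CConvExistsAt f k x) :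
    CConvExistsAt f (c • k) x :=
  (Integrable.const_mul h c).congr (Eventually.of_forall fun y => by
    simp only [ContinuousLinearMap.mul_apply', Pi.smul_apply, smul_eq_mul]
    ring)

variable {ι : Type*} {s : Finset ι} {K : ι → ℝ → ℂ}

theorem CConvExistsAt.sum (h : ∀ i ∈ s, CConvExistsAt f (K i) x) :
    CConvExistsAt f (∑ i ∈ s, K i) x :=
  (integrable_finsetSum s h).congr (Eventually.of_forall fun y => by
    simp [Finset.sum_apply])

theorem cconv_sum_right (h : ∀ i ∈ s, CConvExistsAt f (K i) x) :
    cconv f (∑ i ∈ s, K i) x = ∑ i ∈ s, cconv f (K i) x := by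
  simp only [cconv, MeasureTheory.convolution, Finset.sum_apply, map_sum]
  exact integral_finsetSum s h

theorem cconv_sub_right {l : ℝ → ℂ} (hk : CConvExistsAt f k x) (hl : CConvExistsAt f l x) :
    cconv f (k - l) x = cconv f k x - cconv f l x := by
  simp only [cconv, MeasureTheory.convolution, Pi.sub_apply, map_sub]
  exact integral_sub hk hl

theorem cconv_congr_of_causal (hk : ∀ t ≤ 0, k t = 0) (h : ∀ᵐ y, y < x → f y = g y) :
    cconv f k x = cconv g k x := by
  refine integral_congr_ae ?_
  filter_upwards [h] with y hy
  by_cases hxy : y < x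
  · rw [hy hxy]
  · simp [hk (x - y) (by linarith)]

theorem norm_le_exp_mul_norm_expWeight {c : ℝ} (hη : 0 ≤ η) (f : ℝ → ℂ) (hx : x ≤ c) :
    ‖f x‖ ≤ Real.exp (η * c) * ‖expWeight η f x‖ := by
  rw [norm_expWeight, ← mul_assoc, ← Real.exp_add]
  refine le_mul_of_one_le_left (norm_nonneg _) (Real.one_le_exp ?_)
  linarith [mul_le_mul_of_nonneg_left hx hη]

theorem ExpIntegrable.integrableOn_Iio (hη : 0 ≤ η) (hf : ExpIntegrable η f) (c : ℝ) :
    IntegrableOn f (Iio c) := by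
  refine Integrable.mono' ((Integrable.norm hf).const_mul (Real.exp (η * c))).integrableOn
    hf.aestronglyMeasurable.restrict ?_
  filter_upwards [ae_restrict_mem measurableSet_Iio] with x hx
  exact norm_le_exp_mul_norm_expWeight hη f (le_of_lt hx)

theorem ExpIntegrable.setIntegral_Iio_norm_le (hη : 0 ≤ η) (hf : ExpIntegrable η f) (c : ℝ) :
    ∫ x in Iio c, ‖f x‖ ≤ Real.exp (η * c) * expNorm η f := by
  have hint := (Integrable.norm hf).const_mul (Real.exp (η * c))
  calc ∫ x in Iio c, ‖f x‖ ≤ ∫ x in Iio c, Real.exp (η * c) * ‖expWeight η f x‖ :=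
        setIntegral_mono_on (hf.integrableOn_Iio hη c).norm hint.integrableOn measurableSet_Iio
          fun x hx => norm_le_exp_mul_norm_expWeight hη f (le_of_lt hx)
    _ ≤ ∫ x, Real.exp (η * c) * ‖expWeight η f x‖ :=
        setIntegral_le_integral hint (Eventually.of_forall fun x => by positivity)
    _ = Real.exp (η * c) * expNorm η f := integral_const_mul _ _

end Weight

/-! ### Riemann-Liouville integrals as convolutions -/

/-- The kernel of the Riemann-Liouville integral, extended by zero to the negative half-line. -/
def causalKernel (α : ℂ) : ℝ → ℂ := (Ioi 0).indicator (rlKernel α)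

theorem norm_rlKernel (α : ℂ) {t : ℝ} (ht : 0 < t) :
    ‖rlKernel α t‖ = ‖(Complex.Gamma α)⁻¹‖ * t ^ (α.re - 1) := by
  rw [rlKernel, norm_mul, Complex.norm_cpow_eq_rpow_re_of_pos ht, Complex.sub_re, Complex.one_re]

theorem measurable_rlKernel (α : ℂ) : Measurable (rlKernel α) := by
  unfold rlKernel
  fun_prop

theorem rlKernel_natCast_succ (k : ℕ) (t : ℝ) :
    rlKernel (k + 1 : ℕ) t = (k.factorial : ℂ)⁻¹ * (t : ℂ) ^ k := by
  rw [rlKernel, Nat.cast_succ, Complex.Gamma_nat_eq_factorial, add_sub_cancel_right,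
    Complex.cpow_natCast]

theorem causalKernel_of_nonpos (α : ℂ) {t : ℝ} (ht : t ≤ 0) : causalKernel α t = 0 :=
  indicator_of_notMem (notMem_Ioi.2 ht) _

theorem expIntegrable_causalKernel {η : ℝ} {α : ℂ} (hη : 0 < η) (hα : 0 < α.re) :
    ExpIntegrable η (causalKernel α) := by
  have hdom := (integrableOn_rpow_mul_exp_neg_mul_rpow (p := 1) (s := α.re - 1) (b := η)
    (by linarith) one_pos hη).const_mul ‖(Complex.Gamma α)⁻¹‖
  have hint : IntegrableOn (expWeight η (rlKernel α)) (Ioi 0) := by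
    refine Integrable.mono' hdom (aestronglyMeasurable_expWeight η
      (measurable_rlKernel α).aestronglyMeasurable).restrict ?_
    filter_upwards [ae_restrict_mem measurableSet_Ioi] with t ht
    rw [norm_expWeight, norm_rlKernel α ht, Real.rpow_one]
    exact le_of_eq (by ring_nf)
  refine (hint.integrable_indicator measurableSet_Ioi).congr (Eventually.of_forall fun t => ?_)
  by_cases ht : t ∈ Ioi (0 : ℝ) <;> simp [expWeight, causalKernel, ht]

theorem causalKernel_mul_causalKernel_sub (α β : ℂ) (x y : ℝ) :
    causalKernel α y * causalKernel β (x - y) =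
      (Ioo 0 x).indicator (fun y => (Complex.Gamma α)⁻¹ * (Complex.Gamma β)⁻¹ *
        ((y : ℂ) ^ (α - 1) * ((x : ℂ) - y) ^ (β - 1))) y := by
  rcases le_or_gt y 0 with hy | hy
  · simp [causalKernel_of_nonpos α hy, hy.not_gt]
  rcases le_or_gt x y with hxy | hxy
  · simp [causalKernel_of_nonpos β (sub_nonpos.2 hxy), hxy.not_gt]
  rw [indicator_of_mem (show y ∈ Ioo 0 x from ⟨hy, hxy⟩), causalKernel, causalKernel,
    indicator_of_mem (mem_Ioi.2 hy), indicator_of_mem (mem_Ioi.2 (sub_pos.2 hxy)), rlKernel,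
    rlKernel]
  push_cast
  ring

theorem cconv_causalKernel {α β : ℂ} (hα : 0 < α.re) (hβ : 0 < β.re) :
    cconv (causalKernel α) (causalKernel β) = causalKernel (α + β) := by
  funext x
  simp only [cconv, MeasureTheory.convolution, ContinuousLinearMap.mul_apply',
    causalKernel_mul_causalKernel_sub]
  rw [integral_indicator measurableSet_Ioo, integral_const_mul]
  rcases le_or_gt x 0 with hx | hx
  · simp [causalKernel_of_nonpos _ hx, hx]
  · rw [← integral_Ioc_eq_integral_Ioo, ← intervalIntegral.integral_of_le hx.le,
      Complex.betaIntegral_scaled α β hx, causalKernel, indicator_of_mem (mem_Ioi.2 hx), rlKernel,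
      Complex.betaIntegral_eq_Gamma_mul_div α β hα hβ]
    have hΓα := Complex.Gamma_ne_zero_of_re_pos hα
    have hΓβ := Complex.Gamma_ne_zero_of_re_pos hβ
    field_simp

theorem measurableSet_interval (a b : EReal) : MeasurableSet (interval a b) :=
  (measurableSet_lt measurable_const measurable_coe_real_ereal).inter
    (measurableSet_lt measurable_coe_real_ereal measurable_const)

theorem interval_subset_Iio (a : EReal) (c : ℝ) : interval a c ⊆ Iio c :=
  fun _ hx => EReal.coe_lt_coe_iff.1 hx.2

theorem interval_subset_interval_right (a : EReal) {b c : EReal} (h : b ≤ c) :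
    interval a b ⊆ interval a c :=
  fun _ hx => ⟨hx.1, hx.2.trans_le h⟩

theorem indicator_mul_causalKernel_sub (a : EReal) {c x : ℝ} (hx : x ≤ c) (α : ℂ)
    (f : ℝ → ℂ) (y : ℝ) :
    (interval a c).indicator f y * causalKernel α (x - y) =
      (interval a x).indicator
        (fun y => (Complex.Gamma α)⁻¹ * (f y * ((x - y : ℝ) : ℂ) ^ (α - 1))) y := by
  by_cases hy : y ∈ interval a x
  · have hxy : x - y ∈ Ioi (0 : ℝ) := mem_Ioi.2 (sub_pos.2 (interval_subset_Iio a x hy))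
    rw [indicator_of_mem hy, causalKernel, indicator_of_mem hxy, rlKernel,
      indicator_of_mem (interval_subset_interval_right a (EReal.coe_le_coe_iff.2 hx) hy)]
    ring
  · rw [indicator_of_notMem hy]
    by_cases hyc : y ∈ interval a c
    · have hxy : x ≤ y := not_lt.1 fun h => hy ⟨hyc.1, EReal.coe_lt_coe_iff.2 h⟩
      rw [causalKernel_of_nonpos α (sub_nonpos.2 hxy), mul_zero]
    · rw [indicator_of_notMem hyc, zero_mul]

theorem riemannLiouville_eq_cconv (a : EReal) {c x : ℝ} (hx : x ≤ c) (α : ℂ) (f : ℝ → ℂ) :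
    riemannLiouville a α f x = cconv ((interval a c).indicator f) (causalKernel α) x := by
  simp only [cconv, MeasureTheory.convolution, ContinuousLinearMap.mul_apply',
    indicator_mul_causalKernel_sub a hx]
  rw [integral_indicator (measurableSet_interval a x), integral_const_mul, riemannLiouville]

theorem CConvExistsAt.integrableOn_interval {a : EReal} {c x : ℝ} (hx : x ≤ c) {α : ℂ}
    (hα : 0 < α.re) {f : ℝ → ℂ}
    (h : CConvExistsAt ((interval a c).indicator f) (causalKernel α) x) :
    IntegrableOn (fun y => f y * ((x - y : ℝ) : ℂ) ^ (α - 1)) (interval a x) := by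
  simp only [CConvExistsAt, ConvolutionExistsAt, ContinuousLinearMap.mul_apply',
    indicator_mul_causalKernel_sub a hx,
    integrable_indicator_iff (measurableSet_interval a x)] at h
  refine (h.const_mul (Complex.Gamma α)).congr (Eventually.of_forall fun y => ?_)
  simp only [mul_inv_cancel_left₀ (Complex.Gamma_ne_zero_of_re_pos hα)]

theorem integ_eq_riemannLiouville (a : EReal) (f : ℝ → ℂ) :
    integ a f = riemannLiouville a 1 f := by
  funext x
  simp [integ, riemannLiouville]

theorem riemannLiouville_of_le {a : EReal} {x : ℝ} (hx : x ≤ a) (α : ℂ) (f : ℝ → ℂ) :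
    riemannLiouville a α f x = 0 := by
  have hempty : interval a x = ∅ :=
    eq_empty_of_forall_notMem fun y hy => (hy.1.trans hy.2).not_ge hx
  simp [riemannLiouville, hempty]

section Exp

variable {a : EReal} {c η : ℝ} {f : ℝ → ℂ}

theorem ae_riemannLiouville_of_ae_eq (hη : 0 < η)
    (hf : ExpIntegrable η ((interval a c).indicator f)) {g : ℝ → ℂ} {α β : ℂ} (hα : 0 < α.re)
    (hβ : 0 < β.re) (hg : ∀ᵐ x, x ∈ interval a c → g x = riemannLiouville a α f x) :
    ∀ᵐ x, x ∈ interval a c → riemannLiouville a β g x = riemannLiouville a (α + β) f x := by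
  filter_upwards [hf.ae_cconv_assoc (expIntegrable_causalKernel hη hα)
    (expIntegrable_causalKernel hη hβ)] with x hassoc hx
  have hxc : x < c := interval_subset_Iio a c hx
  rw [riemannLiouville_eq_cconv a hxc.le, riemannLiouville_eq_cconv a hxc.le,
    ← cconv_causalKernel hα hβ, ← hassoc]
  refine cconv_congr_of_causal (fun t => causalKernel_of_nonpos β) ?_
  filter_upwards [hg] with y hy hyx
  rw [← riemannLiouville_eq_cconv a (hyx.trans hxc).le]
  by_cases hya : a < y
  · have hmem : y ∈ interval a c := ⟨hya, EReal.coe_lt_coe_iff.2 (hyx.trans hxc)⟩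
    rw [indicator_of_mem hmem, hy hmem]
  · rw [indicator_of_notMem fun h => hya h.1, riemannLiouville_of_le (not_lt.1 hya)]

theorem natCast_succ_re_pos (k : ℕ) : 0 < ((k + 1 : ℕ) : ℂ).re := by
  rw [Complex.natCast_re]
  exact_mod_cast k.succ_pos

theorem ae_iterate_integ_succ (hη : 0 < η)
    (hf : ExpIntegrable η ((interval a c).indicator f)) (k : ℕ) :
    ∀ᵐ x, x ∈ interval a c → (integ a)^[k + 1] f x = riemannLiouville a (k + 1 : ℕ) f x := by
  induction k with
  | zero =>
    refine Eventually.of_forall fun x _ => ?_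
    rw [zero_add, Function.iterate_one, Nat.cast_one, integ_eq_riemannLiouville]
  | succ k ih =>
    filter_upwards [ae_riemannLiouville_of_ae_eq hη hf (natCast_succ_re_pos k)
      (by simp : 0 < (1 : ℂ).re) ih] with x hx hxc
    rw [Function.iterate_succ_apply', integ_eq_riemannLiouville, hx hxc, Nat.cast_succ (k + 1)]

end Exp

/-! ### Convergence of the Newton kernels -/

/-- The error `∑_{n < N} P_n(α) L_n'(t) - t^(α - 1) / Γ(α)` of the differentiated Newton-Laguerre
expansion. -/
def newtonDefect (α : ℂ) (N : ℕ) (t : ℝ) : ℂ :=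
  newtonLaguerreDeriv α N t - rlKernel α t

theorem mul_newtonDefect {α : ℂ} (hα : 0 < α.re) (N : ℕ) {t : ℝ} (ht : 0 < t) :
    t * newtonDefect α (N + 1) t =
      α * (newtonLaguerre α (N + 1) t - newtonLaguerreSum α t) +
        (N + 1 : ℕ) * pochhammerNewton (N + 1) α * ((laguerre N).eval t : ℝ) := by
  have ht' : (t : ℂ) ≠ 0 := by exact_mod_cast ht.ne'
  have hα0 : α ≠ 0 := fun h => by simp [h] at hα
  have hpow : (t : ℂ) * (t : ℂ) ^ (α - 1) = (t : ℂ) ^ α := by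
    rw [Complex.cpow_sub _ _ ht', Complex.cpow_one, mul_div_cancel₀ _ ht']
  have hGamma : α * (Complex.Gamma (α + 1))⁻¹ = (Complex.Gamma α)⁻¹ := by
    rw [Complex.Gamma_add_one α hα0, mul_inv, mul_inv_cancel_left₀ hα0]
  rw [newtonDefect, rlKernel, newtonLaguerreSum_eq hα ht, ← hpow, ← hGamma]
  linear_combination mul_newtonLaguerreDeriv α N t

theorem norm_newtonDefect_le {α : ℂ} (hα : 0 < α.re) (N : ℕ) {t : ℝ} (ht : 0 < t) :
    ‖newtonDefect α (N + 1) t‖ ≤ (‖α‖ * ∑' n, ‖pochhammerNewton (n + (N + 1)) α‖ +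
      ‖(N + 1 : ℕ) * pochhammerNewton (N + 1) α‖) * (Real.exp t / t) := by
  have hnorm := congrArg norm (mul_newtonDefect hα N ht)
  rw [norm_mul, Complex.norm_real, Real.norm_of_nonneg ht.le] at hnorm
  rw [← mul_div_assoc, le_div_iff₀ ht, mul_comm, hnorm, add_mul]
  refine (norm_add_le _ _).trans (add_le_add ?_ ?_)
  · rw [norm_mul, mul_assoc]
    exact mul_le_mul_of_nonneg_left (norm_newtonLaguerre_sub_le hα ht.le _) (norm_nonneg _)
  · rw [norm_mul, Complex.norm_real]
    exact mul_le_mul_of_nonneg_left (abs_eval_laguerre_le N ht.le) (norm_nonneg _)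

theorem exists_norm_newtonDefect_le_rpow {α : ℂ} (hα : 0 < α.re) :
    ∃ C : ℝ, 0 ≤ C ∧ ∀ᶠ N : ℕ in atTop, ∀ t : ℝ, 0 < t →
      ‖newtonDefect α N t‖ ≤ C * (N : ℝ) ^ (-(α.re / 2)) * (Real.exp t / t) := by
  obtain ⟨A, hA, htail⟩ := (isBigO_tsum_norm_pochhammerNewton hα).exists_nonneg
  obtain ⟨B, hB, hlast⟩ := (isBigO_natCast_mul_pochhammerNewton α).exists_nonneg
  refine ⟨‖α‖ * A + B, by positivity, ?_⟩
  filter_upwards [htail.bound, hlast.bound, eventually_ge_atTop 1] with N htail hlast hN t ht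
  have hN1 : (1 : ℝ) ≤ N := by exact_mod_cast hN
  have hdecay : (N : ℝ) ^ (-α.re) ≤ (N : ℝ) ^ (-(α.re / 2)) :=
    Real.rpow_le_rpow_of_exponent_le hN1 (by linarith)
  rw [Real.norm_of_nonneg (tsum_nonneg fun _ => norm_nonneg _),
    Real.norm_of_nonneg (by positivity)] at htail
  rw [Real.norm_of_nonneg (by positivity)] at hlast
  obtain ⟨M, rfl⟩ := Nat.exists_eq_add_of_le' hN
  refine (norm_newtonDefect_le hα M ht).trans (mul_le_mul_of_nonneg_right ?_ (by positivity))
  rw [add_mul, mul_assoc]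
  gcongr
  exact hlast.trans (by gcongr)

theorem tendsto_newtonDefect {α : ℂ} (hα : 0 < α.re) {t : ℝ} (ht : 0 < t) :
    Tendsto (fun N => newtonDefect α N t) atTop (𝓝 0) := by
  obtain ⟨C, -, hC⟩ := exists_norm_newtonDefect_le_rpow hα
  refine squeeze_zero_norm' (hC.mono fun N h => h t ht) ?_
  simpa using (((tendsto_rpow_neg_atTop (half_pos hα)).comp
    tendsto_natCast_atTop_atTop).const_mul C).mul_const (Real.exp t / t)

theorem norm_newtonLaguerreDeriv_le {α : ℂ} (hα : 0 < α.re) (N : ℕ) {t : ℝ} (ht : 0 < t) :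
    ‖newtonLaguerreDeriv α N t‖ ≤
      (∑' n, ‖pochhammerNewton n α‖) * (√N * Real.exp t * t ^ (-(1 / 2) : ℝ)) := by
  calc ‖newtonLaguerreDeriv α N t‖
      ≤ ∑ n ∈ Finset.range N,
          ‖pochhammerNewton n α‖ * (√N * Real.exp t * t ^ (-(1 / 2) : ℝ)) := by
        refine norm_sum_le_of_le _ fun n hn => ?_
        have hnN : (n : ℝ) ≤ N := by exact_mod_cast (Finset.mem_range.1 hn).le
        rw [norm_mul, Complex.norm_real]
        refine mul_le_mul_of_nonneg_left ((abs_eval_derivative_laguerre_le n ht).trans ?_)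
          (norm_nonneg _)
        gcongr
    _ ≤ _ := by
        rw [← Finset.sum_mul]
        gcongr
        exact (summable_norm_pochhammerNewton hα).sum_le_tsum _ fun _ _ => norm_nonneg _

theorem norm_newtonDefect_le_of_natCast_le {α : ℂ} (hα : 0 < α.re) {N : ℕ} {t : ℝ} (ht : 0 < t)
    (hN : (N : ℝ) ≤ t ^ (-(1 / 2) : ℝ)) : ‖newtonDefect α N t‖ ≤
      (∑' n, ‖pochhammerNewton n α‖) * (Real.exp t * t ^ (1 / 4 - 1 : ℝ)) +
        ‖(Complex.Gamma α)⁻¹‖ * (Real.exp t * t ^ (α.re - 1)) := by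
  have : 0 ≤ ∑' n, ‖pochhammerNewton n α‖ := tsum_nonneg fun _ => norm_nonneg _
  have hsqrt : √N * t ^ (-(1 / 2) : ℝ) ≤ t ^ (1 / 4 - 1 : ℝ) := by
    calc √N * t ^ (-(1 / 2) : ℝ) ≤ √(t ^ (-(1 / 2) : ℝ)) * t ^ (-(1 / 2) : ℝ) := by gcongr
      _ = t ^ (1 / 4 - 1 : ℝ) := by
        rw [Real.sqrt_eq_rpow, ← Real.rpow_mul ht.le, ← Real.rpow_add ht]
        norm_num
  calc ‖newtonDefect α N t‖
      ≤ (∑' n, ‖pochhammerNewton n α‖) * (√N * Real.exp t * t ^ (-(1 / 2) : ℝ)) +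
          ‖(Complex.Gamma α)⁻¹‖ * t ^ (α.re - 1) :=
        norm_sub_le_of_le (norm_newtonLaguerreDeriv_le hα N ht) (norm_rlKernel α ht).le
    _ ≤ _ := by
        rw [mul_comm √_, mul_assoc (Real.exp t)]
        gcongr
        exact le_mul_of_one_le_left (by positivity) (Real.one_le_exp ht.le)

/-- For `N ≤ t^(-1/2)` the energy bound on `L_n'` suffices; for `N > t^(-1/2)` the decay of the tail
`∑_{n ≥ N} |P_n(α)|` gains a power of `t` over the non-integrable `1 / t`. -/
theorem exists_norm_newtonDefect_le {α : ℂ} (hα : 0 < α.re) :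
    ∃ C : ℝ, ∀ᶠ N : ℕ in atTop, ∀ t : ℝ, 0 < t → ‖newtonDefect α N t‖ ≤
      C * (Real.exp t * (t ^ (1 / 4 - 1 : ℝ) + t ^ (α.re / 4 - 1) + t ^ (α.re - 1))) := by
  obtain ⟨A, hA, htail⟩ := exists_norm_newtonDefect_le_rpow hα
  have hS : 0 ≤ ∑' n, ‖pochhammerNewton n α‖ := tsum_nonneg fun _ => norm_nonneg _
  refine ⟨∑' n, ‖pochhammerNewton n α‖ + A + ‖(Complex.Gamma α)⁻¹‖, htail.mono fun N hN t ht => ?_⟩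
  rw [mul_add (Real.exp t), mul_add (Real.exp t)]
  set S := ∑' n, ‖pochhammerNewton n α‖
  set G := ‖(Complex.Gamma α)⁻¹‖
  have hG : 0 ≤ G := norm_nonneg _
  have hpos (s : ℝ) : 0 ≤ Real.exp t * t ^ s := by positivity
  rcases le_or_gt (N : ℝ) (t ^ (-(1 / 2) : ℝ)) with hsmall | hlarge
  · refine (norm_newtonDefect_le_of_natCast_le hα ht hsmall).trans ?_
    nlinarith [hpos (1 / 4 - 1), hpos (α.re / 4 - 1), hpos (α.re - 1)]
  · have hdecay : (N : ℝ) ^ (-(α.re / 2)) ≤ t ^ (α.re / 4) := by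
      calc (N : ℝ) ^ (-(α.re / 2)) ≤ (t ^ (-(1 / 2) : ℝ)) ^ (-(α.re / 2)) :=
            Real.rpow_le_rpow_of_nonpos (by positivity) hlarge.le (by linarith)
        _ = t ^ (α.re / 4) := by
          rw [← Real.rpow_mul ht.le]
          ring_nf
    calc ‖newtonDefect α N t‖ ≤ A * t ^ (α.re / 4) * (Real.exp t / t) := (hN t ht).trans (by gcongr)
      _ = A * (Real.exp t * t ^ (α.re / 4 - 1)) := by
          rw [Real.rpow_sub_one ht.ne']
          ring
      _ ≤ _ := by nlinarith [hpos (1 / 4 - 1), hpos (α.re / 4 - 1), hpos (α.re - 1)]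

theorem measurable_newtonDefect (α : ℂ) (N : ℕ) : Measurable (newtonDefect α N) := by
  refine Measurable.sub ?_ (measurable_rlKernel α)
  unfold newtonLaguerreDeriv
  fun_prop

/-- The kernel of the difference between the `N`-th Newton sum of the integration operator, without
its multiple of the identity, and the Riemann-Liouville integral. -/
def newtonKernel (ρ : ℝ) (α : ℂ) (N : ℕ) : ℝ → ℂ :=
  (Ioi 0).indicator fun t => (ρ : ℂ) ^ (α - 1) * newtonDefect α N (t / ρ)

theorem aestronglyMeasurable_newtonKernel (ρ : ℝ) (α : ℂ) (N : ℕ) :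
    AEStronglyMeasurable (newtonKernel ρ α N) :=
  ((((measurable_newtonDefect α N).comp (measurable_id.div_const ρ)).const_mul _).indicator
    measurableSet_Ioi).aestronglyMeasurable

theorem tendsto_newtonKernel {α : ℂ} (hα : 0 < α.re) {ρ : ℝ} (hρ : 0 < ρ) (t : ℝ) :
    Tendsto (fun N => newtonKernel ρ α N t) atTop (𝓝 0) := by
  by_cases ht : t ∈ Ioi (0 : ℝ)
  · simpa [newtonKernel, ht] using (tendsto_newtonDefect hα (div_pos ht hρ)).const_mul _
  · simp [newtonKernel, ht]

theorem integrableOn_exp_neg_mul_mul_rpow_div {ρ η s : ℝ} (hρ : 0 < ρ) (hη : 1 / ρ < η)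
    (hs : 0 < s) : IntegrableOn
      (fun t => Real.exp (-(η * t)) * (Real.exp (t / ρ) * (t / ρ) ^ (s - 1))) (Ioi 0) := by
  refine IntegrableOn.congr_fun ((integrableOn_rpow_mul_exp_neg_mul_rpow (p := 1) (s := s - 1)
    (b := η - 1 / ρ) (by linarith) one_pos (by linarith)).const_mul ((ρ ^ (s - 1))⁻¹))
    (fun t ht => ?_) measurableSet_Ioi
  rw [Real.div_rpow (le_of_lt ht) hρ.le, Real.rpow_one, ← mul_assoc (Real.exp _),
    ← Real.exp_add, show -(η - 1 / ρ) * t = -(η * t) + t / ρ by ring]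
  ring

theorem exists_integrable_bound_newtonKernel {α : ℂ} (hα : 0 < α.re) {ρ η : ℝ} (hρ : 0 < ρ)
    (hη : 1 / ρ < η) : ∃ g : ℝ → ℝ, Integrable g ∧
      ∀ᶠ N in atTop, ∀ t, ‖expWeight η (newtonKernel ρ α N) t‖ ≤ g t := by
  obtain ⟨C, hbound⟩ := exists_norm_newtonDefect_le hα
  have hint {s : ℝ} (hs : 0 < s) := integrableOn_exp_neg_mul_mul_rpow_div hρ hη hs
  have hdom := (((hint (s := 1 / 4) (by norm_num)).add (hint (s := α.re / 4) (by positivity))).add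
    (hint hα)).const_mul (‖(ρ : ℂ) ^ (α - 1)‖ * C)
  refine ⟨_, IntegrableOn.integrable_indicator hdom measurableSet_Ioi, hbound.mono fun N hN t => ?_⟩
  rw [norm_expWeight, newtonKernel]
  by_cases ht : t ∈ Ioi (0 : ℝ)
  · rw [indicator_of_mem ht, indicator_of_mem ht, norm_mul]
    refine (mul_le_mul_of_nonneg_left (mul_le_mul_of_nonneg_left (hN _ (div_pos ht hρ))
      (norm_nonneg _)) (Real.exp_pos _).le).trans_eq ?_
    simp only [Pi.add_apply]
    ring
  · simp [ht]

theorem eventually_expIntegrable_newtonKernel {α : ℂ} (hα : 0 < α.re) {ρ η : ℝ} (hρ : 0 < ρ)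
    (hη : 1 / ρ < η) : ∀ᶠ N in atTop, ExpIntegrable η (newtonKernel ρ α N) := by
  obtain ⟨g, hg, hbound⟩ := exists_integrable_bound_newtonKernel hα hρ hη
  exact hbound.mono fun N hN => hg.mono' (aestronglyMeasurable_expWeight η
    (aestronglyMeasurable_newtonKernel ρ α N)) (Eventually.of_forall hN)

theorem tendsto_expNorm_newtonKernel {α : ℂ} (hα : 0 < α.re) {ρ η : ℝ} (hρ : 0 < ρ)
    (hη : 1 / ρ < η) : Tendsto (fun N => expNorm η (newtonKernel ρ α N)) atTop (𝓝 0) := by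
  obtain ⟨g, hg, hbound⟩ := exists_integrable_bound_newtonKernel hα hρ hη
  have hlim : ∀ᵐ t, Tendsto (fun N => ‖expWeight η (newtonKernel ρ α N) t‖) atTop (𝓝 0) :=
    Eventually.of_forall fun t => by
      simpa [expWeight] using ((tendsto_newtonKernel hα hρ t).const_smul
        (Real.exp (-(η * t)))).norm
  simpa [expNorm] using tendsto_integral_filter_of_dominated_convergence g
    (Eventually.of_forall fun N => (aestronglyMeasurable_expWeight η
      (aestronglyMeasurable_newtonKernel ρ α N)).norm)
    (hbound.mono fun N hN => Eventually.of_forall fun t => by simpa using hN t) hg hlim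

/-! ### Newton sums of the integration operator on functions -/

/-- The coefficient of `T ^ k` in the `n`-th term of the Newton series of `T`. -/
def newtonCoeff (ρ : ℝ) (α : ℂ) (n k : ℕ) : ℂ :=
  pochhammerNewton n α * (pochhammerNewton k n * (ρ : ℂ) ^ (α - k))

theorem newtonCoeff_zero_right (ρ : ℝ) (α : ℂ) (n : ℕ) :
    newtonCoeff ρ α n 0 = (ρ : ℂ) ^ α * pochhammerNewton n α := by
  simp only [newtonCoeff, pochhammerNewton_zero, Nat.cast_zero, sub_zero]
  ring

theorem cpow_mul_rlKernel_div {ρ t : ℝ} (hρ : 0 < ρ) (ht : 0 ≤ t) (α : ℂ) :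
    (ρ : ℂ) ^ (α - 1) * rlKernel α (t / ρ) = rlKernel α t := by
  have hpow : (ρ : ℂ) ^ (α - 1) ≠ 0 := by simp [Complex.cpow_eq_zero_iff, hρ.ne']
  rw [rlKernel, rlKernel, Complex.ofReal_div, Complex.div_cpow_ofReal_nonneg ht hρ.le]
  field_simp

theorem cpow_mul_newtonLaguerreDeriv_div {ρ : ℝ} (hρ : 0 < ρ) (α : ℂ) (N : ℕ) (t : ℝ) :
    (ρ : ℂ) ^ (α - 1) * newtonLaguerreDeriv α N (t / ρ) =
      ∑ n ∈ Finset.range N, ∑ k ∈ Finset.range n,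
        newtonCoeff ρ α n (k + 1) * rlKernel (k + 1 : ℕ) t := by
  have hρ' : (ρ : ℂ) ≠ 0 := by exact_mod_cast hρ.ne'
  have hpow (k : ℕ) : (ρ : ℂ) ^ (α - (k + 1 : ℕ)) = (ρ : ℂ) ^ (α - 1) * ((ρ : ℂ) ^ k)⁻¹ := by
    rw [← Complex.cpow_natCast, ← Complex.cpow_neg, ← Complex.cpow_add _ _ hρ']
    congr 1
    push_cast
    ring
  rw [newtonLaguerreDeriv, Finset.mul_sum]
  refine Finset.sum_congr rfl fun n _ => ?_
  rw [eval_derivative_laguerre, Complex.ofReal_sum, Finset.mul_sum, Finset.mul_sum]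
  refine Finset.sum_congr rfl fun k _ => ?_
  rw [newtonCoeff, rlKernel_natCast_succ, pochhammerNewton_natCast, hpow]
  push_cast
  rw [div_pow]
  field_simp

theorem newtonKernel_eq {ρ : ℝ} (hρ : 0 < ρ) (α : ℂ) (N : ℕ) :
    newtonKernel ρ α N = (∑ n ∈ Finset.range N, ∑ k ∈ Finset.range n,
      newtonCoeff ρ α n (k + 1) • causalKernel (k + 1 : ℕ)) - causalKernel α := by
  funext t
  by_cases ht : t ∈ Ioi (0 : ℝ)
  · rw [newtonKernel, indicator_of_mem ht, newtonDefect, mul_sub,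
      cpow_mul_rlKernel_div hρ (le_of_lt ht), cpow_mul_newtonLaguerreDeriv_div hρ]
    simp only [Pi.sub_apply, Finset.sum_apply, Pi.smul_apply, causalKernel, indicator_of_mem ht,
      smul_eq_mul]
  · simp [newtonKernel, causalKernel, ht]

theorem newtonSumFun_eq (a : EReal) (ρ : ℝ) (α : ℂ) (f : ℝ → ℂ) (N : ℕ) (x : ℝ) :
    newtonSumFun a ρ α f N x = (ρ : ℂ) ^ α * (∑ n ∈ Finset.range N, pochhammerNewton n α) * f x +
      ∑ n ∈ Finset.range N, ∑ k ∈ Finset.range n,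
        newtonCoeff ρ α n (k + 1) * (integ a)^[k + 1] f x := by
  rw [newtonSumFun, Finset.mul_sum, Finset.sum_mul, ← Finset.sum_add_distrib]
  refine Finset.sum_congr rfl fun n _ => ?_
  rw [← newtonCoeff_zero_right, Finset.mul_sum, Finset.sum_range_succ', add_comm]
  simp only [newtonCoeff, mul_assoc, Function.iterate_zero, id]

section Functions

variable {a : EReal} {c η ρ : ℝ} {α : ℂ} {f : ℝ → ℂ}

theorem ae_newtonSumFun_sub (hη : 0 < η) (hρ : 0 < ρ) (hα : 0 < α.re)
    (hf : ExpIntegrable η ((interval a c).indicator f)) (N : ℕ) :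
    ∀ᵐ x, x ∈ interval a c → newtonSumFun a ρ α f N x - riemannLiouville a α f x =
      (ρ : ℂ) ^ α * (∑ n ∈ Finset.range N, pochhammerNewton n α) * f x +
        cconv ((interval a c).indicator f) (newtonKernel ρ α N) x := by
  filter_upwards [ae_all_iff.2 (ae_iterate_integ_succ hη hf),
    hf.ae_cconvExistsAt (expIntegrable_causalKernel hη hα), ae_all_iff.2 fun k : ℕ =>
      hf.ae_cconvExistsAt (expIntegrable_causalKernel hη (natCast_succ_re_pos k))]
    with x hiter hexα hex hx
  have hxc : x ≤ c := (interval_subset_Iio a c hx).le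
  have hterm (n k : ℕ) := (hex k).const_smul (newtonCoeff ρ α n (k + 1))
  have hinner (n : ℕ) := CConvExistsAt.sum (s := Finset.range n) fun k _ => hterm n k
  rw [newtonKernel_eq hρ, cconv_sub_right (CConvExistsAt.sum fun n _ => hinner n) hexα,
    cconv_sum_right fun n _ => hinner n, newtonSumFun_eq, riemannLiouville_eq_cconv a hxc,
    add_sub_assoc]
  congr 2
  refine Finset.sum_congr rfl fun n _ => ?_
  rw [cconv_sum_right fun k _ => hterm n k]
  refine Finset.sum_congr rfl fun k _ => ?_
  rw [cconv_const_smul_right, hiter k hx, riemannLiouville_eq_cconv a hxc]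

theorem ExpIntegrable.integrableOn_cconv_interval {k : ℝ → ℂ} (hη : 0 ≤ η)
    (hf : ExpIntegrable η f) (hk : ExpIntegrable η k) (a : EReal) (c : ℝ) :
    IntegrableOn (cconv f k) (interval a c) :=
  ((hf.convolution hk).integrableOn_Iio hη c).mono_set (interval_subset_Iio a c)

theorem ExpIntegrable.setIntegral_norm_cconv_interval_le {k : ℝ → ℂ} (hη : 0 ≤ η)
    (hf : ExpIntegrable η f) (hk : ExpIntegrable η k) (a : EReal) (c : ℝ) :
    ∫ x in interval a c, ‖cconv f k x‖ ≤ Real.exp (η * c) * (expNorm η f * expNorm η k) :=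
  calc ∫ x in interval a c, ‖cconv f k x‖ ≤ ∫ x in Iio c, ‖cconv f k x‖ :=
        setIntegral_mono_set ((hf.convolution hk).integrableOn_Iio hη c).norm
          (Eventually.of_forall fun _ => norm_nonneg _) (interval_subset_Iio a c).eventuallyLE
    _ ≤ Real.exp (η * c) * expNorm η (cconv f k) := (hf.convolution hk).setIntegral_Iio_norm_le hη c
    _ ≤ _ := mul_le_mul_of_nonneg_left (expNorm_cconv_le hf hk) (Real.exp_pos _).le

theorem integrableOn_riemannLiouville (hη : 0 < η) (hα : 0 < α.re)
    (hf : ExpIntegrable η ((interval a c).indicator f)) :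
    IntegrableOn (riemannLiouville a α f) (interval a c) :=
  (hf.integrableOn_cconv_interval hη.le (expIntegrable_causalKernel hη hα) a c).congr_fun
    (fun _ hx => (riemannLiouville_eq_cconv a (interval_subset_Iio a c hx).le α f).symm)
    (measurableSet_interval a c)

theorem ae_integrableOn_riemannLiouville (hη : 0 < η) (hα : 0 < α.re)
    (hf : ExpIntegrable η ((interval a c).indicator f)) :
    ∀ᵐ x ∂(volume.restrict (interval a c)),
      IntegrableOn (fun y => f y * ((x - y : ℝ) : ℂ) ^ (α - 1)) (interval a x) := by
  rw [ae_restrict_iff' (measurableSet_interval a c)]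
  filter_upwards [hf.ae_cconvExistsAt (expIntegrable_causalKernel hη hα)] with x hx hxc
  exact hx.integrableOn_interval (interval_subset_Iio a c hxc).le hα

theorem integrableOn_iterate_integ_succ (hη : 0 < η)
    (hf : ExpIntegrable η ((interval a c).indicator f)) (k : ℕ) :
    IntegrableOn ((integ a)^[k + 1] f) (interval a c) := by
  refine (integrableOn_riemannLiouville hη (natCast_succ_re_pos k) hf).congr ?_
  rw [EventuallyEq, ae_restrict_iff' (measurableSet_interval a c)]
  filter_upwards [ae_iterate_integ_succ hη hf k] with x hx hxc
  exact (hx hxc).symm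

theorem integrableOn_newtonSumFun_sub (hη : 0 < η) (hα : 0 < α.re)
    (hfi : IntegrableOn f (interval a c)) (hf : ExpIntegrable η ((interval a c).indicator f))
    (N : ℕ) : IntegrableOn (fun x => newtonSumFun a ρ α f N x - riemannLiouville a α f x)
      (interval a c) := by
  refine Integrable.sub (integrable_finsetSum _ fun n _ => Integrable.const_mul
    (integrable_finsetSum _ fun k _ => Integrable.const_mul ?_ _) _)
    (integrableOn_riemannLiouville hη hα hf)
  cases k with
  | zero => exact hfi
  | succ k => exact integrableOn_iterate_integ_succ hη hf k

theorem setIntegral_norm_newtonSumFun_sub_le (hη : 0 < η) (hρ : 0 < ρ) (hα : 0 < α.re)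
    (hfi : IntegrableOn f (interval a c)) (hf : ExpIntegrable η ((interval a c).indicator f))
    {N : ℕ} (hK : ExpIntegrable η (newtonKernel ρ α N)) :
    ∫ x in interval a c, ‖newtonSumFun a ρ α f N x - riemannLiouville a α f x‖ ≤
      ‖(ρ : ℂ) ^ α * ∑ n ∈ Finset.range N, pochhammerNewton n α‖ *
        (∫ x in interval a c, ‖f x‖) + Real.exp (η * c) *
          (expNorm η ((interval a c).indicator f) * expNorm η (newtonKernel ρ α N)) := by
  have hconv := hf.integrableOn_cconv_interval hη.le hK a c
  have hae := (ae_restrict_iff' (measurableSet_interval a c)).2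
    (ae_newtonSumFun_sub hη hρ hα hf N)
  calc ∫ x in interval a c, ‖newtonSumFun a ρ α f N x - riemannLiouville a α f x‖
      ≤ ∫ x in interval a c, (‖(ρ : ℂ) ^ α * ∑ n ∈ Finset.range N, pochhammerNewton n α‖ *
          ‖f x‖ + ‖cconv ((interval a c).indicator f) (newtonKernel ρ α N) x‖) := by
        refine integral_mono_ae (integrableOn_newtonSumFun_sub hη hα hfi hf N).norm
          ((hfi.norm.const_mul _).add hconv.norm) (hae.mono fun x hx => ?_)
        simp only [hx]
        exact (norm_add_le _ _).trans_eq (by rw [norm_mul])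
    _ ≤ _ := by
        rw [integral_add (hfi.norm.const_mul _) hconv.norm, integral_const_mul]
        gcongr
        exact hf.setIntegral_norm_cconv_interval_le hη.le hK a c

theorem tendsto_eLpNorm_newtonSumFun_sub (hρ : 0 < ρ) (hη : 1 / ρ < η) (hα : 0 < α.re)
    (hfi : IntegrableOn f (interval a c)) (hf : ExpIntegrable η ((interval a c).indicator f)) :
    Tendsto (fun N => eLpNorm
        (fun x => newtonSumFun a ρ α f N x - riemannLiouville a α f x) 1
        (volume.restrict (interval a c))) atTop (𝓝 0) := by
  have hη0 : 0 < η := (one_div_pos.2 hρ).trans hη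
  have hbound := ENNReal.tendsto_ofReal
    ((((tendsto_sum_pochhammerNewton hα).const_mul ((ρ : ℂ) ^ α)).norm.mul_const
      (∫ x in interval a c, ‖f x‖)).add (((tendsto_expNorm_newtonKernel hα hρ hη).const_mul
        (expNorm η ((interval a c).indicator f))).const_mul (Real.exp (η * c))))
  simp only [mul_zero, norm_zero, zero_mul, add_zero, ENNReal.ofReal_zero] at hbound
  refine tendsto_of_tendsto_of_tendsto_of_le_of_le' tendsto_const_nhds hbound
    (Eventually.of_forall fun _ => zero_le) ?_
  filter_upwards [eventually_expIntegrable_newtonKernel hα hρ hη] with N hN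
  rw [eLpNorm_one_eq_lintegral_enorm, ← ofReal_integral_norm_eq_lintegral_enorm
    (integrableOn_newtonSumFun_sub hη0 hα hfi hf N)]
  exact ENNReal.ofReal_le_ofReal (setIntegral_norm_newtonSumFun_sub_le hη0 hρ hα hfi hf hN)

end Functions

theorem norm_expWeight_indicator_le {a η : ℝ} (hη : 0 ≤ η) {s : Set ℝ} (hs : s ⊆ Ici a)
    (f : ℝ → ℂ) (x : ℝ) :
    ‖expWeight η (s.indicator f) x‖ ≤ Real.exp (-(η * a)) * ‖s.indicator f x‖ := by
  rw [norm_expWeight]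
  by_cases hx : x ∈ s
  · gcongr
    exact hs hx
  · simp [hx]

theorem expIntegrable_indicator_of_subset_Ici {a η : ℝ} {f : ℝ → ℂ} {s : Set ℝ} (hη : 0 ≤ η)
    (hs : MeasurableSet s) (hsa : s ⊆ Ici a) (hf : IntegrableOn f s) :
    ExpIntegrable η (s.indicator f) :=
  Integrable.mono' ((hf.integrable_indicator hs).norm.const_mul _)
    (aestronglyMeasurable_expWeight η (hf.integrable_indicator hs).aestronglyMeasurable)
    (Eventually.of_forall (norm_expWeight_indicator_le hη hsa f))

theorem expNorm_indicator_le {a η : ℝ} {f : ℝ → ℂ} {s : Set ℝ} (hη : 0 ≤ η)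
    (hs : MeasurableSet s) (hsa : s ⊆ Ici a) (hf : IntegrableOn f s) :
    expNorm η (s.indicator f) ≤ Real.exp (-(η * a)) * ∫ x in s, ‖f x‖ := by
  refine (integral_mono (Integrable.norm (expIntegrable_indicator_of_subset_Ici hη hs hsa hf))
    ((hf.integrable_indicator hs).norm.const_mul _)
    (norm_expWeight_indicator_le hη hsa f)).trans_eq ?_
  simp only [integral_const_mul, norm_indicator_eq_indicator_norm, integral_indicator hs]

theorem exists_integrableOn_expWeight_Iic_of_isBigO {η ε : ℝ} {f : ℝ → ℂ} (hε : η < ε)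
    (hf : AEStronglyMeasurable f) (hO : f =O[atBot ⊓ ae volume] fun x => Real.exp (ε * x)) :
    ∃ x₀, IntegrableOn (expWeight η f) (Iic x₀) := by
  have hweight : expWeight η f =O[atBot ⊓ ae volume] fun x => Real.exp ((ε - η) * x) := by
    refine ((Asymptotics.isBigO_refl (fun x : ℝ => Real.exp (-(η * x))) _).smul hO).congr_right
      fun x => ?_
    rw [smul_eq_mul, ← Real.exp_add]
    ring_nf
  have hexp : IntegrableAtFilter (fun x => Real.exp ((ε - η) * x)) (atBot ⊓ ae volume) :=
    IntegrableAtFilter.inf_ae_iff.2 ⟨Iic 0, Iic_mem_atBot 0,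
      integrableOn_exp_mul_Iic (sub_pos.2 hε) 0⟩
  exact integrableAtFilter_atBot_iff.1 (IntegrableAtFilter.inf_ae_iff.1
    (hweight.integrableAtFilter ⟨univ, univ_mem,
      (aestronglyMeasurable_expWeight η hf).restrict⟩ hexp))

theorem expIntegrable_of_isBigO {η ε : ℝ} {f : ℝ → ℂ} (hη : 0 ≤ η) (hε : η < ε)
    (hf : Integrable f) (hO : f =O[atBot ⊓ ae volume] fun x => Real.exp (ε * x)) :
    ExpIntegrable η f := by
  obtain ⟨x₀, hleft⟩ := exists_integrableOn_expWeight_Iic_of_isBigO hε hf.aestronglyMeasurable hO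
  have hright : IntegrableOn (expWeight η f) (Ioi x₀) :=
    Integrable.mono' (hf.norm.const_mul (Real.exp (-(η * x₀)))).integrableOn
      (aestronglyMeasurable_expWeight η hf.aestronglyMeasurable).restrict
      ((ae_restrict_mem measurableSet_Ioi).mono fun x hx => by
        have hx' : x₀ ≤ x := le_of_lt hx
        rw [norm_expWeight]
        gcongr)
  rw [ExpIntegrable, ← integrableOn_univ, ← Iic_union_Ioi (a := x₀)]
  exact hleft.union hright

theorem exists_expIntegrable {a : EReal} {c ε₀ : ℝ} {f : ℝ → ℂ} (ha : a ≠ ⊤) (hε₀ : 0 ≤ ε₀)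
    (hf : IntegrableOn f (interval a c))
    (hO : a = ⊥ → ∃ ε : ℝ, ε₀ < ε ∧ f =O[atBot ⊓ ae volume] fun x => Real.exp (ε * x)) :
    ∃ η : ℝ, ε₀ < η ∧ ExpIntegrable η ((interval a c).indicator f) := by
  induction a with
  | bot =>
    obtain ⟨ε, hε, hO⟩ := hO rfl
    obtain ⟨η, hη, hηε⟩ := exists_between hε
    exact ⟨η, hη, expIntegrable_of_isBigO (hε₀.trans hη.le) hηε
      (hf.integrable_indicator (measurableSet_interval ⊥ c))
      ((Asymptotics.isBigO_of_le _ (norm_indicator_le_norm_self f)).trans hO)⟩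
  | top => exact absurd rfl ha
  | coe a =>
    exact ⟨ε₀ + 1, lt_add_one ε₀, expIntegrable_indicator_of_subset_Ici (by positivity)
      (measurableSet_interval a c) (fun x hx => (EReal.coe_lt_coe_iff.1 hx.1).le) hf⟩

/-! ### The integration operator on `L¹(a, b)` -/

theorem integ_congr {a b : ℝ} {f g : ℝ → ℂ} (h : f =ᵐ[volume.restrict (Ioo a b)] g) {x : ℝ}
    (hx : x ∈ Ioo a b) : integ a f x = integ a g x := by
  simpa only [volterra, integ, interval_coe, mul_one] using
    volterra_congr (k := fun _ => 1) h hx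

theorem coeFn_integOp_pow {a b : ℝ} (f : L1 a b) (k : ℕ) :
    (integOp a b ^ k) f =ᵐ[volume.restrict (Ioo a b)] (integ a)^[k] f := by
  induction k with
  | zero => rfl
  | succ k ih =>
    rw [pow_succ', mul_apply_eq_comp, Function.iterate_succ_apply']
    filter_upwards [coeFn_integOp ((integOp a b ^ k) f), ae_restrict_mem measurableSet_Ioo]
      with x hx hxab
    rw [hx, integ_congr ih hxab]

theorem integOp_pow_succ (a b : ℝ) (k : ℕ) :
    integOp a b ^ (k + 1) = riemannLiouvilleOp a b (k + 1 : ℕ) (natCast_succ_re_pos k) := by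
  ext1 f
  have hf : ExpIntegrable 1 ((interval a b).indicator f) := by
    rw [interval_coe]
    exact expIntegrable_indicator_of_subset_Ici zero_le_one measurableSet_Ioo
      (fun x hx => hx.1.le) (integrableOn_coe f)
  refine Lp.ext ?_
  filter_upwards [coeFn_integOp_pow f (k + 1), coeFn_riemannLiouvilleOp (natCast_succ_re_pos k) f,
    ae_restrict_of_ae (ae_iterate_integ_succ one_pos hf k), ae_restrict_mem measurableSet_Ioo]
    with x hpow hRL hiter hx
  rw [hpow, hRL, hiter (by rwa [interval_coe])]

theorem norm_volterraOp_le {a b : ℝ} {k : ℝ → ℂ} (hk : IntegrableOn k (Ioo 0 (b - a))) :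
    ‖volterraOp a b k hk‖ ≤ ∫ x in Ioo 0 (b - a), ‖k x‖ :=
  LinearMap.mkContinuous_norm_le _ (integral_nonneg fun _ => norm_nonneg _) _

theorem norm_integOp_pow_le {a b : ℝ} (hab : a ≤ b) (k : ℕ) :
    ‖integOp a b ^ (k + 1)‖ ≤ (b - a) ^ k / k.factorial * (b - a) := by
  rw [integOp_pow_succ]
  have hbound (t : ℝ) (ht : t ∈ Ioo 0 (b - a)) :
      ‖rlKernel (k + 1 : ℕ) t‖ ≤ (b - a) ^ k / k.factorial := by
    rw [rlKernel_natCast_succ, norm_mul, norm_inv, Complex.norm_natCast, norm_pow,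
      Complex.norm_real, Real.norm_of_nonneg ht.1.le, inv_mul_eq_div]
    gcongr
    · exact ht.1.le
    · exact ht.2.le
  calc ‖riemannLiouvilleOp a b (k + 1 : ℕ) (natCast_succ_re_pos k)‖
      ≤ ∫ t in Ioo 0 (b - a), ‖rlKernel (k + 1 : ℕ) t‖ := norm_volterraOp_le _
    _ ≤ ∫ _ in Ioo 0 (b - a), (b - a) ^ k / k.factorial :=
        setIntegral_mono_on (integrableOn_rlKernel (natCast_succ_re_pos k) _).norm
          (integrableOn_const (by simp)) measurableSet_Ioo hbound
    _ = (b - a) ^ k / k.factorial * (b - a) := by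
        rw [setIntegral_const, Real.volume_real_Ioo_of_le (sub_nonneg.2 hab), sub_zero,
          smul_eq_mul, mul_comm]

theorem spectrum_integOp_subset {a b : ℝ} (hab : a ≤ b) : spectrum ℂ (integOp a b) ⊆ {0} := by
  intro z hz
  by_contra hne
  have hz0 : 0 < ‖z‖ := norm_pos_iff.2 hne
  set C := (b - a) * ‖(1 : L1 a b →L[ℂ] L1 a b)‖
  have hbound (k : ℕ) : ‖z‖ ≤ C * (((b - a) / ‖z‖) ^ k / k.factorial) := by
    have hspec := spectrum.norm_le_norm_mul_of_mem (spectrum.pow_mem_pow (integOp a b) (k + 1) hz)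
    have hpow := hspec.trans (mul_le_mul_of_nonneg_right (norm_integOp_pow_le hab k)
      (norm_nonneg _))
    rw [norm_pow, pow_succ'] at hpow
    refine ((le_div_iff₀ (pow_pos hz0 k)).2 hpow).trans_eq ?_
    rw [div_pow]
    ring
  have hlim := (FloorSemiring.tendsto_pow_div_factorial_atTop ((b - a) / ‖z‖)).const_mul C
  rw [mul_zero] at hlim
  exact hz0.not_ge (ge_of_tendsto' hlim hbound)

theorem coeFn_sum_smul {a b : ℝ} {ι : Type*} {s : Finset ι} (c : ι → ℂ) {u : ι → L1 a b}
    {v : ι → ℝ → ℂ} (h : ∀ i ∈ s, u i =ᵐ[volume.restrict (Ioo a b)] v i) :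
    (∑ i ∈ s, c i • u i : L1 a b) =ᵐ[volume.restrict (Ioo a b)]
      fun x => ∑ i ∈ s, c i * v i x := by
  have hterm : ∀ i ∈ s, (c i • u i : L1 a b) =ᵐ[volume.restrict (Ioo a b)]
      fun x => c i * v i x := by
    intro i hi
    filter_upwards [Lp.coeFn_smul (c i) (u i), h i hi] with x hsmul hu
    rw [hsmul, Pi.smul_apply, hu, smul_eq_mul]
  filter_upwards [Lp.coeFn_finsetSum s fun i => c i • u i, (Finset.eventually_all s).2 hterm]
    with x hsum hx
  rw [hsum, Finset.sum_apply]
  exact Finset.sum_congr rfl hx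

theorem coeFn_newtonSum {a b : ℝ} (ρ : ℝ) (α : ℂ) (N : ℕ) (f : L1 a b) :
    newtonSum ρ α (integOp a b) N f =ᵐ[volume.restrict (Ioo a b)] newtonSumFun a ρ α f N := by
  have happly : newtonSum ρ α (integOp a b) N f = ∑ n ∈ Finset.range N, pochhammerNewton n α •
      ∑ k ∈ Finset.range (n + 1), (pochhammerNewton k n * (ρ : ℂ) ^ (α - k)) •
        (integOp a b ^ k) f := by
    simp only [newtonSum, sum_apply, smul_apply]
  rw [happly]
  exact coeFn_sum_smul _ fun n _ => coeFn_sum_smul _ fun k _ => coeFn_integOp_pow f k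

theorem norm_newtonSum_integOp_sub_le {a b η ρ : ℝ} {α : ℂ} (hη : 0 < η) (hρ : 0 < ρ)
    (hα : 0 < α.re) {N : ℕ} (hK : ExpIntegrable η (newtonKernel ρ α N)) :
    ‖newtonSum ρ α (integOp a b) N - riemannLiouvilleOp a b α hα‖ ≤
      ‖(ρ : ℂ) ^ α * ∑ n ∈ Finset.range N, pochhammerNewton n α‖ +
        Real.exp (η * (b - a)) * expNorm η (newtonKernel ρ α N) := by
  have hKnn : 0 ≤ expNorm η (newtonKernel ρ α N) := integral_nonneg fun _ => norm_nonneg _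
  refine ContinuousLinearMap.opNorm_le_bound _ (by positivity) fun f => ?_
  have hf := integrableOn_coe f
  have hsub : Ioo a b ⊆ Ici a := fun x hx => hx.1.le
  have hexp := expIntegrable_indicator_of_subset_Ici hη.le measurableSet_Ioo hsub hf
  have hnorm := expNorm_indicator_le hη.le measurableSet_Ioo hsub hf
  rw [L1.norm_eq_integral_norm, L1.norm_eq_integral_norm]
  calc ∫ x in Ioo a b, ‖(newtonSum ρ α (integOp a b) N - riemannLiouvilleOp a b α hα) f x‖
      = ∫ x in Ioo a b, ‖newtonSumFun a ρ α f N x - riemannLiouville a α f x‖ := by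
        refine integral_congr_ae ?_
        filter_upwards [Lp.coeFn_sub (newtonSum ρ α (integOp a b) N f)
          (riemannLiouvilleOp a b α hα f), coeFn_newtonSum ρ α N f,
          coeFn_riemannLiouvilleOp hα f] with x hsub hsum hRL
        rw [sub_apply, hsub, Pi.sub_apply, hsum, hRL]
    _ ≤ ‖(ρ : ℂ) ^ α * ∑ n ∈ Finset.range N, pochhammerNewton n α‖ * (∫ x in Ioo a b, ‖f x‖) +
          Real.exp (η * b) * (expNorm η ((Ioo a b).indicator f) *
            expNorm η (newtonKernel ρ α N)) := by
        simp only [← interval_coe] at hf hexp ⊢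
        exact setIntegral_norm_newtonSumFun_sub_le hη hρ hα hf hexp hK
    _ ≤ ‖(ρ : ℂ) ^ α * ∑ n ∈ Finset.range N, pochhammerNewton n α‖ * (∫ x in Ioo a b, ‖f x‖) +
          Real.exp (η * b) * (Real.exp (-(η * a)) * (∫ x in Ioo a b, ‖f x‖) *
            expNorm η (newtonKernel ρ α N)) := by gcongr
    _ = _ := by
        rw [show η * (b - a) = η * b + -(η * a) by ring, Real.exp_add]
        ring

theorem tendsto_newtonSum_integOp {α : ℂ} (hα : 0 < α.re) (a b : ℝ) {ρ : ℝ} (hρ : 0 < ρ) :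
    Tendsto (newtonSum ρ α (integOp a b)) atTop (𝓝 (riemannLiouvilleOp a b α hα)) := by
  have hη : 1 / ρ < 1 / ρ + 1 := lt_add_one _
  have hη0 : 0 < 1 / ρ + 1 := by positivity
  have hbound := ((tendsto_sum_pochhammerNewton hα).const_mul ((ρ : ℂ) ^ α)).norm.add
    ((tendsto_expNorm_newtonKernel hα hρ hη).const_mul (Real.exp ((1 / ρ + 1) * (b - a))))
  simp only [mul_zero, norm_zero, add_zero] at hbound
  rw [tendsto_iff_norm_sub_tendsto_zero]
  refine squeeze_zero' (Eventually.of_forall fun _ => norm_nonneg _) ?_ hbound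
  filter_upwards [eventually_expIntegrable_newtonKernel hα hρ hη] with N hN
  exact norm_newtonSum_integOp_sub_le hη0 hρ hα hN

/-! ### The holomorphic functional calculus near a point -/

theorem hasSum_circleIntegral {ι E : Type*} [Countable ι] [NormedAddCommGroup E]
    [NormedSpace ℂ E] [CompleteSpace E] {f : ι → ℂ → E} {g : ℂ → E} {u : ι → ℝ} {c : ℂ} {R : ℝ}
    (hR : 0 ≤ R) (hf : ∀ i, ContinuousOn (f i) (Metric.sphere c R)) (hu : Summable u)
    (hfu : ∀ i, ∀ z ∈ Metric.sphere c R, ‖f i z‖ ≤ u i)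
    (hg : ∀ z ∈ Metric.sphere c R, HasSum (fun i => f i z) (g z)) :
    HasSum (fun i => ∮ z in C(c, R), f i z) (∮ z in C(c, R), g z) := by
  have hunif := (tendstoUniformlyOn_tsum hu hfu).congr_right fun z hz => (hg z hz).tsum_eq
  refine (hunif.tendsto_circleIntegral_of_continuousOn hR
    (Eventually.of_forall fun s => continuousOn_finsetSum s fun i _ => hf i)).congr fun s => ?_
  exact circleIntegral.integral_fun_sum fun i _ => (hf i).circleIntegrable hR

theorem iteratedDeriv_cpow_const (α : ℂ) (n : ℕ) {z : ℂ} (hz : z ∈ Complex.slitPlane) :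
    iteratedDeriv n (fun z : ℂ => z ^ α) z = n.factorial * Ring.choose α n * z ^ (α - n) := by
  induction n generalizing z with
  | zero => simp
  | succ n ih =>
    have hev : iteratedDeriv n (fun z : ℂ => z ^ α) =ᶠ[𝓝 z]
        fun z => n.factorial * Ring.choose α n * z ^ (α - n) := by
      filter_upwards [Complex.isOpen_slitPlane.mem_nhds hz] with y hy using ih hy
    have hderiv := ((hasDerivAt_id' z).cpow_const (c := α - n) hz).const_mul
      (n.factorial * Ring.choose α n)
    rw [iteratedDeriv_succ, hev.deriv_eq, hderiv.deriv, Nat.factorial_succ]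
    push_cast
    rw [show α - (n + 1 : ℂ) = α - n - 1 by ring]
    linear_combination -(n.factorial : ℂ) * z ^ (α - n - 1) * add_one_mul_choose_succ α n

theorem differentiableOn_cpow_const (α : ℂ) {s : Set ℂ} (hs : s ⊆ Complex.slitPlane) :
    DifferentiableOn ℂ (fun z : ℂ => z ^ α) s :=
  differentiableOn_id.cpow_const fun _ hz => hs hz

theorem circleIntegral_cpow_mul_inv_sub_pow {c : ℂ} {R : ℝ} (hR : 0 < R)
    (hcR : Metric.closedBall c R ⊆ Complex.slitPlane) (α : ℂ) (k : ℕ) :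
    ∮ z in C(c, R), z ^ α * ((z - c)⁻¹) ^ (k + 1) =
      2 * Real.pi * Complex.I * (Ring.choose α k * c ^ (α - k)) := by
  have hfact : (k.factorial : ℂ) ≠ 0 := by exact_mod_cast k.factorial_ne_zero
  have hcauchy :=
    (differentiableOn_cpow_const α hcR).circleIntegral_one_div_sub_center_pow_smul hR k
  rw [iteratedDeriv_cpow_const α k (hcR (Metric.mem_closedBall_self hR.le))] at hcauchy
  simp only [smul_eq_mul, one_div, ← inv_pow, mul_comm _ (_ ^ α)] at hcauchy
  rw [hcauchy]
  field_simp

section BanachAlgebra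

variable {A : Type*} [NormedRing A] [NormedAlgebra ℂ A] [CompleteSpace A] {T : A} {c : ℂ} {R : ℝ}

theorem summable_norm_pow_div_of_spectralRadius_lt
    (hT : spectralRadius ℂ T < ENNReal.ofReal R) : Summable fun k => ‖T ^ k‖ / R ^ k := by
  obtain ⟨q, hTq, hqR⟩ := ENNReal.lt_iff_exists_nnreal_btwn.1 hT
  rw [← ENNReal.ofReal_coe_nnreal,
    ENNReal.ofReal_lt_ofReal_iff_of_nonneg q.coe_nonneg] at hqR
  have hR : 0 < R := q.coe_nonneg.trans_lt hqR
  refine Summable.of_norm_bounded_eventually_nat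
    (summable_geometric_of_lt_one (by positivity) ((div_lt_one hR).2 hqR)) ?_
  filter_upwards [(spectrum.pow_norm_pow_one_div_tendsto_nhds_spectralRadius T).eventually_lt_const
    hTq, eventually_gt_atTop 0] with k hk hk0
  have hroot : ‖T ^ k‖ ^ (1 / k : ℝ) ≤ q := by
    rw [← ENNReal.ofReal_coe_nnreal] at hk
    exact ((ENNReal.ofReal_lt_ofReal_iff_of_nonneg (by positivity)).1 hk).le
  have hpow : ‖T ^ k‖ ≤ q ^ k := by
    rwa [one_div, Real.rpow_inv_le_iff_of_pos (norm_nonneg _) q.coe_nonneg (by positivity),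
      Real.rpow_natCast] at hroot
  rw [norm_div, norm_norm, norm_pow R, Real.norm_of_nonneg hR.le, div_pow]
  gcongr

theorem hasSum_resolvent_of_spectralRadius_lt {z : ℂ} (hT : spectralRadius ℂ T < ‖z‖₊) :
    HasSum (fun k : ℕ => (z⁻¹) ^ (k + 1) • T ^ k) (resolvent T z) := by
  have hz : z ≠ 0 := by
    rintro rfl
    simp at hT
  have hsum : Summable fun k : ℕ => (z⁻¹ • T) ^ k := by
    rw [← enorm_eq_nnnorm, ← ofReal_norm] at hT
    refine Summable.of_norm ((summable_norm_pow_div_of_spectralRadius_lt hT).congr fun k => ?_)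
    rw [smul_pow, norm_smul, norm_pow z⁻¹, norm_inv, inv_pow, inv_mul_eq_div]
  have hfactor : algebraMap ℂ A z - T = z • (1 - z⁻¹ • T) := by
    rw [smul_sub, smul_inv_smul₀ hz, Algebra.algebraMap_eq_smul_one]
  let u : Aˣ := ⟨algebraMap ℂ A z - T, z⁻¹ • ∑' k : ℕ, (z⁻¹ • T) ^ k,
    by rw [hfactor, smul_mul_smul_comm, mul_inv_cancel₀ hz, hsum.one_sub_mul_tsum_pow, one_smul],
    by rw [hfactor, smul_mul_smul_comm, inv_mul_cancel₀ hz, hsum.tsum_pow_mul_one_sub, one_smul]⟩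
  have hres : resolvent T z = z⁻¹ • ∑' k : ℕ, (z⁻¹ • T) ^ k := Ring.inverse_unit u
  rw [hres]
  refine (hsum.hasSum.const_smul z⁻¹).congr_fun fun k => ?_
  rw [smul_pow, smul_smul, pow_succ']

theorem resolvent_sub_algebraMap {R A : Type*} [CommRing R] [Ring A] [Algebra R A] (T : A)
    (c z : R) :
    resolvent (T - algebraMap R A c) (z - c) = resolvent T z := by
  rw [resolvent, resolvent, map_sub, sub_sub_sub_cancel_right]

theorem hasSum_circleIntegral_cpow_smul_resolvent
    (hcR : Metric.closedBall c R ⊆ Complex.slitPlane)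
    (hT : spectralRadius ℂ (T - algebraMap ℂ A c) < ENNReal.ofReal R) (α : ℂ) :
    HasSum (fun k => (Ring.choose α k * c ^ (α - k)) • (T - algebraMap ℂ A c) ^ k)
      ((2 * Real.pi * Complex.I : ℂ)⁻¹ • ∮ z in C(c, R), z ^ α • resolvent T z) := by
  have hR : 0 < R := ENNReal.ofReal_pos.1 (bot_le.trans_lt hT)
  have hsphere : Metric.sphere c R ⊆ Complex.slitPlane := Metric.sphere_subset_closedBall.trans hcR
  have hcont := (differentiableOn_cpow_const α hsphere).continuousOn
  obtain ⟨B, hB⟩ := (isCompact_sphere c R).exists_bound_of_continuousOn hcont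
  have hnorm (z : ℂ) (hz : z ∈ Metric.sphere c R) : ‖z - c‖ = R := mem_sphere_iff_norm.1 hz
  have hne (z : ℂ) (hz : z ∈ Metric.sphere c R) : z - c ≠ 0 :=
    norm_pos_iff.1 ((hnorm z hz).symm ▸ hR)
  have hexchange : HasSum
      (fun k => ∮ z in C(c, R), (z ^ α * ((z - c)⁻¹) ^ (k + 1)) • (T - algebraMap ℂ A c) ^ k)
      (∮ z in C(c, R), z ^ α • resolvent T z) := by
    refine hasSum_circleIntegral hR.le (fun k => ?_)
      ((summable_norm_pow_div_of_spectralRadius_lt hT).mul_left (B / R)) (fun k z hz => ?_)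
      fun z hz => ?_
    · exact (hcont.mul (((continuousOn_id.sub continuousOn_const).inv₀ hne).pow _)).smul
        continuousOn_const
    · rw [norm_smul, norm_mul, norm_pow, norm_inv, hnorm z hz]
      calc ‖z ^ α‖ * R⁻¹ ^ (k + 1) * ‖(T - algebraMap ℂ A c) ^ k‖
          ≤ B * R⁻¹ ^ (k + 1) * ‖(T - algebraMap ℂ A c) ^ k‖ := by gcongr; exact hB z hz
        _ = B / R * (‖(T - algebraMap ℂ A c) ^ k‖ / R ^ k) := by rw [inv_pow, pow_succ]; field_simp
    · have hres := hasSum_resolvent_of_spectralRadius_lt (z := z - c) (by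
        rwa [← enorm_eq_nnnorm, ← ofReal_norm, hnorm z hz])
      rw [resolvent_sub_algebraMap] at hres
      simpa only [smul_smul] using hres.const_smul (z ^ α)
  refine (hexchange.const_smul (2 * Real.pi * Complex.I : ℂ)⁻¹).congr_fun fun k => ?_
  rw [circleIntegral.integral_smul_const, circleIntegral_cpow_mul_inv_sub_pow hR hcR,
    mul_smul _ (_ * _) (_ ^ k), inv_smul_smul₀ Complex.two_pi_I_ne_zero]

end BanachAlgebra

/-! ### Fractional powers as Abel means of the Newton series -/

section Abel

variable {E : Type*} [NormedAddCommGroup E] {s : ℕ → E} {r : ℝ}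

theorem summable_pow_mul_norm_of_tendsto {l : E} (hs : Tendsto s atTop (𝓝 l)) (hr₀ : 0 ≤ r)
    (hr₁ : r < 1) : Summable fun n => r ^ n * ‖s n‖ := by
  obtain ⟨B, hB⟩ := hs.norm.bddAbove_range
  exact Summable.of_nonneg_of_le (fun n => by positivity)
    (fun n => mul_le_mul_of_nonneg_left (hB ⟨n, rfl⟩) (by positivity))
    ((summable_geometric_of_lt_one hr₀ hr₁).mul_right B)

theorem hasSum_pow_smul_sub [NormedSpace ℝ E] {σ : E} (hs : HasSum (fun n => r ^ n • s (n + 1)) σ) :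
    HasSum (fun n => r ^ n • (s (n + 1) - s n)) ((1 - r) • σ - s 0) := by
  have hshift : HasSum (fun n => r ^ n • s n) (r • σ + s 0) := by
    rw [← hasSum_nat_add_iff' 1]
    simpa [pow_succ', mul_smul] using hs.const_smul r
  convert hs.sub hshift using 1
  · simp only [smul_sub]
  · rw [sub_smul, one_smul]
    abel

theorem tendsto_one_sub_mul_tsum_pow_mul_norm (hs : Tendsto s atTop (𝓝 0)) :
    Tendsto (fun r : ℝ => (1 - r) * ∑' n, r ^ n * ‖s (n + 1)‖) (𝓝[<] 1) (𝓝 0) := by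
  have hpartial : Tendsto (fun N => ∑ n ∈ Finset.range N, (‖s (n + 1)‖ - ‖s n‖)) atTop
      (𝓝 (0 - ‖s 0‖)) := by
    simp only [Finset.sum_range_sub fun n => ‖s n‖]
    exact (tendsto_zero_iff_norm_tendsto_zero.1 hs).sub_const _
  have habel := (Real.tendsto_tsum_powerSeries_nhdsWithin_lt hpartial).add_const ‖s 0‖
  rw [sub_add_cancel] at habel
  refine habel.congr' ?_
  filter_upwards [Ioo_mem_nhdsLT (zero_lt_one' ℝ)] with r hr
  have hsum := hasSum_pow_smul_sub (s := fun n => ‖s n‖) (summable_pow_mul_norm_of_tendsto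
    ((tendsto_add_atTop_iff_nat 1).2 hs) hr.1.le hr.2).hasSum
  simp only [smul_eq_mul, mul_comm (r ^ _) (_ - _)] at hsum
  rw [hsum.tsum_eq, sub_add_cancel]

-- Mathlib's Abel limit theorem is scalar; it is applied to the norms of the remainders.
theorem tendsto_tsum_pow_smul_nhdsLT [NormedSpace ℝ E] [CompleteSpace E] {u : ℕ → E} {l : E}
    (hu : Tendsto (fun N => ∑ n ∈ Finset.range N, u n) atTop (𝓝 l)) :
    Tendsto (fun r : ℝ => ∑' n, r ^ n • u n) (𝓝[<] 1) (𝓝 l) := by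
  set e : ℕ → E := fun N => ∑ n ∈ Finset.range N, u n - l
  have he : Tendsto e atTop (𝓝 0) := tendsto_sub_nhds_zero_iff.2 hu
  have hdiff (n : ℕ) : e (n + 1) - e n = u n := by
    simp only [e, sub_sub_sub_cancel_right, Finset.sum_range_succ, add_sub_cancel_left]
  rw [tendsto_iff_norm_sub_tendsto_zero]
  refine squeeze_zero' (Eventually.of_forall fun _ => norm_nonneg _) ?_
    (tendsto_one_sub_mul_tsum_pow_mul_norm he)
  filter_upwards [Ioo_mem_nhdsLT (zero_lt_one' ℝ)] with r hr
  have hsummable : Summable fun n => ‖r ^ n • e (n + 1)‖ := by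
    simp only [norm_smul, norm_pow, Real.norm_of_nonneg hr.1.le]
    exact summable_pow_mul_norm_of_tendsto ((tendsto_add_atTop_iff_nat 1).2 he) hr.1.le hr.2
  have htsum : ∑' n, r ^ n • u n - l = (1 - r) • ∑' n, r ^ n • e (n + 1) := by
    have hsum := (hasSum_pow_smul_sub hsummable.of_norm.hasSum).tsum_eq
    simp only [hdiff] at hsum
    rw [hsum]
    simp [e]
  calc ‖∑' n, r ^ n • u n - l‖ = (1 - r) * ‖∑' n, r ^ n • e (n + 1)‖ := by
        rw [htsum, norm_smul, Real.norm_of_nonneg (sub_nonneg.2 hr.2.le)]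
    _ ≤ (1 - r) * ∑' n, ‖r ^ n • e (n + 1)‖ :=
        mul_le_mul_of_nonneg_left (norm_tsum_le_tsum_norm hsummable) (sub_nonneg.2 hr.2.le)
    _ = (1 - r) * ∑' n, r ^ n * ‖e (n + 1)‖ := by
        simp only [norm_smul, norm_pow, Real.norm_of_nonneg hr.1.le]

end Abel

theorem closedBall_ofReal_subset_slitPlane {c R : ℝ} (hR : R < c) :
    Metric.closedBall (c : ℂ) R ⊆ Complex.slitPlane := by
  intro z hz
  have hre := (Complex.abs_re_le_norm (z - c)).trans (mem_closedBall_iff_norm.1 hz)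
  rw [Complex.sub_re, Complex.ofReal_re, abs_le] at hre
  exact Or.inl (by linarith [hre.1])

theorem spectralRadius_sub_algebraMap_le {A : Type*} [NormedRing A] [NormedAlgebra ℂ A] {T : A}
    {c : ℂ} {R : ℝ} (hT : spectrum ℂ T ⊆ Metric.closedBall c R) :
    spectralRadius ℂ (T - algebraMap ℂ A c) ≤ ENNReal.ofReal R := by
  refine iSup₂_le fun z hz => ?_
  rw [← spectrum.sub_singleton_eq, sub_singleton] at hz
  obtain ⟨w, hw, rfl⟩ := hz
  rw [← enorm_eq_nnnorm, ← ofReal_norm]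
  exact ENNReal.ofReal_le_ofReal (mem_closedBall_iff_norm.1 (hT hw))

section Operators

variable {X : Type*} [NormedAddCommGroup X] [NormedSpace ℂ X] {T : X →L[ℂ] X} {ρ ε : ℝ}

theorem newtonSum_eq_sum_one_sub_pow (hρ : 0 < ρ) (α : ℂ) (T : X →L[ℂ] X) (N : ℕ) :
    newtonSum ρ α T N = ∑ n ∈ Finset.range N,
      ((ρ : ℂ) ^ α * pochhammerNewton n α) • (1 - (ρ : ℂ)⁻¹ • T) ^ n := by
  have hρ' : (ρ : ℂ) ≠ 0 := by exact_mod_cast hρ.ne'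
  refine Finset.sum_congr rfl fun n _ => ?_
  have hbinom : (1 - (ρ : ℂ)⁻¹ • T) ^ n = ∑ k ∈ Finset.range (n + 1),
      (pochhammerNewton k n * ((ρ : ℂ) ^ k)⁻¹) • T ^ k := by
    rw [sub_eq_neg_add, (Commute.one_right _).add_pow]
    refine Finset.sum_congr rfl fun k _ => ?_
    rw [one_pow, mul_one, ← neg_smul, smul_pow, pochhammerNewton_natCast, ← nsmul_eq_mul',
      ← Nat.cast_smul_eq_nsmul ℂ, smul_smul]
    congr 1
    rw [neg_pow, inv_pow]
    ring
  rw [hbinom, mul_comm ((ρ : ℂ) ^ α), mul_smul]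
  congr 1
  rw [Finset.smul_sum]
  refine Finset.sum_congr rfl fun k _ => ?_
  rw [smul_smul, Complex.cpow_sub _ _ hρ', Complex.cpow_natCast]
  congr 1
  ring

theorem spectrum_add_smul_id_subset (hε : 0 < ε)
    (hT : spectrum ℂ T ⊆ Metric.closedBall (ρ : ℂ) ρ) :
    spectrum ℂ (T + (ε : ℂ) • ContinuousLinearMap.id ℂ X) ⊆
      Metric.ball ((ρ + ε : ℝ) : ℂ) (ρ + ε / 2) := by
  have hid : (ε : ℂ) • ContinuousLinearMap.id ℂ X = algebraMap ℂ (X →L[ℂ] X) ε := by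
    rw [Algebra.algebraMap_eq_smul_one, ContinuousLinearMap.one_def]
  rw [hid, ← spectrum.add_singleton_eq, add_singleton]
  rintro _ ⟨z, hz, rfl⟩
  rw [mem_ball_iff_norm, Complex.ofReal_add, add_sub_add_right_eq_sub]
  linarith [mem_closedBall_iff_norm.1 (hT hz)]

section Complete

variable [CompleteSpace X]

theorem hasSum_holomorphicPower_add (hρ : 0 < ρ) (hε : 0 < ε)
    (hT : spectrum ℂ T ⊆ Metric.closedBall (ρ : ℂ) ρ) (α : ℂ) :
    HasSum (fun n => (((ρ + ε : ℝ) : ℂ) ^ α * (pochhammerNewton n α * (ρ / (ρ + ε) : ℝ) ^ n)) •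
        (1 - (ρ : ℂ)⁻¹ • T) ^ n)
      ((2 * Real.pi * Complex.I : ℂ)⁻¹ • ∮ z in C((ρ + ε : ℝ), ρ + ε / 2),
        z ^ α • resolvent (T + (ε : ℂ) • ContinuousLinearMap.id ℂ X) z) := by
  have hρ' : (ρ : ℂ) ≠ 0 := by exact_mod_cast hρ.ne'
  have hc' : ((ρ + ε : ℝ) : ℂ) ≠ 0 := by exact_mod_cast (add_pos hρ hε).ne'
  have hshift : T + (ε : ℂ) • ContinuousLinearMap.id ℂ X - algebraMap ℂ _ ((ρ + ε : ℝ) : ℂ) =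
      T - algebraMap ℂ _ (ρ : ℂ) := by
    rw [Algebra.algebraMap_eq_smul_one, Algebra.algebraMap_eq_smul_one, Complex.ofReal_add,
      add_smul, ← ContinuousLinearMap.one_def]
    abel
  have hscale : T - algebraMap ℂ _ (ρ : ℂ) = (-ρ : ℂ) • (1 - (ρ : ℂ)⁻¹ • T) := by
    rw [Algebra.algebraMap_eq_smul_one, smul_sub, smul_smul, neg_mul, mul_inv_cancel₀ hρ',
      neg_smul, neg_smul, one_smul]
    abel
  have hradius : spectralRadius ℂ (T - algebraMap ℂ _ (ρ : ℂ)) < ENNReal.ofReal (ρ + ε / 2) :=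
    (spectralRadius_sub_algebraMap_le hT).trans_lt
      ((ENNReal.ofReal_lt_ofReal_iff (by linarith)).2 (by linarith))
  have hsum := hasSum_circleIntegral_cpow_smul_resolvent
    (closedBall_ofReal_subset_slitPlane (by linarith : ρ + ε / 2 < ρ + ε)) (hshift ▸ hradius) α
  have hterm (n : ℕ) :
      (((ρ + ε : ℝ) : ℂ) ^ α * (pochhammerNewton n α * (ρ / (ρ + ε) : ℝ) ^ n)) •
        (1 - (ρ : ℂ)⁻¹ • T) ^ n =
      (Ring.choose α n * ((ρ + ε : ℝ) : ℂ) ^ (α - n)) •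
        (T + (ε : ℂ) • ContinuousLinearMap.id ℂ X - algebraMap ℂ _ ((ρ + ε : ℝ) : ℂ)) ^ n := by
    rw [hshift, hscale, smul_pow, smul_smul, pochhammerNewton_eq_choose,
      Complex.cpow_sub _ _ hc', Complex.cpow_natCast, neg_pow]
    congr 1
    push_cast
    ring
  simp only [hterm]
  exact hsum

theorem holomorphicPower_add_eq_smul_tsum (hρ : 0 < ρ) (hε : 0 < ε)
    (hT : spectrum ℂ T ⊆ Metric.closedBall (ρ : ℂ) ρ) (α : ℂ) :
    ((2 * Real.pi * Complex.I : ℂ)⁻¹ • ∮ z in C((ρ + ε : ℝ), ρ + ε / 2),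
        z ^ α • resolvent (T + (ε : ℂ) • ContinuousLinearMap.id ℂ X) z) =
      ((1 + ε / ρ : ℝ) : ℂ) ^ α • ∑' n, (ρ / (ρ + ε)) ^ n •
        (((ρ : ℂ) ^ α * pochhammerNewton n α) • (1 - (ρ : ℂ)⁻¹ • T) ^ n) := by
  have hcpow : ((1 + ε / ρ : ℝ) : ℂ) ^ α * (ρ : ℂ) ^ α = ((ρ + ε : ℝ) : ℂ) ^ α := by
    rw [← Complex.mul_cpow_ofReal_nonneg (by positivity) hρ.le, ← Complex.ofReal_mul]
    congr 2
    field_simp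
  rw [← (hasSum_holomorphicPower_add hρ hε hT α).tsum_eq, ← tsum_const_smul'']
  refine tsum_congr fun n => ?_
  rw [← hcpow, ← Complex.coe_smul, smul_smul, smul_smul]
  congr 1
  push_cast
  ring

theorem isFractionalPower_of_tendsto_newtonSum {α : ℂ} {S : X →L[ℂ] X} (hρ : 0 < ρ)
    (hT : spectrum ℂ T ⊆ Metric.closedBall (ρ : ℂ) ρ)
    (hS : Tendsto (newtonSum ρ α T) atTop (𝓝 S)) : IsFractionalPower T α S := by
  refine ⟨_, fun ε hε => ⟨(ρ + ε : ℝ), ρ + ε / 2,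
    closedBall_ofReal_subset_slitPlane (by linarith), spectrum_add_smul_id_subset hε hT, rfl⟩, ?_⟩
  have hratio : Tendsto (fun ε : ℝ => ρ / (ρ + ε)) (𝓝[>] 0) (𝓝[<] 1) := by
    refine tendsto_nhdsWithin_iff.2 ⟨?_, ?_⟩
    · have hcont : ContinuousAt (fun ε : ℝ => ρ / (ρ + ε)) 0 := by fun_prop (disch := simp [hρ.ne'])
      simpa [ContinuousAt, hρ.ne'] using hcont.mono_left nhdsWithin_le_nhds
    · filter_upwards [self_mem_nhdsWithin] with ε hε
      exact (div_lt_one (add_pos hρ hε)).2 (lt_add_of_pos_right ρ hε)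
  have hprefactor : Tendsto (fun ε : ℝ => ((1 + ε / ρ : ℝ) : ℂ) ^ α) (𝓝[>] 0) (𝓝 1) := by
    have hcont : ContinuousAt (fun ε : ℝ => ((1 + ε / ρ : ℝ) : ℂ) ^ α) 0 :=
      ContinuousAt.cpow (by fun_prop) continuousAt_const (by simp)
    simpa [ContinuousAt] using hcont.mono_left nhdsWithin_le_nhds
  have habel := tendsto_tsum_pow_smul_nhdsLT
    (hS.congr fun N => newtonSum_eq_sum_one_sub_pow hρ α T N)
  have hlim := hprefactor.smul (habel.comp hratio)
  rw [one_smul] at hlim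
  refine hlim.congr' ?_
  filter_upwards [self_mem_nhdsWithin] with ε hε
  exact (holomorphicPower_add_eq_smul_tsum hρ hε hT α).symm

end Complete

end Operators

end FracInt

end

theorem mainTheorem11 (α : ℂ) (hα : 0 < α.re) :
    -- bounded intervals: identity of bounded operators on `L¹(a, b)`
    (∀ a b : ℝ, a < b →
      FracInt.IsFractionalPower (FracInt.integOp a b) α (FracInt.riemannLiouvilleOp a b α hα) ∧
      ∀ ρ : ℝ, 0 < ρ →
        Tendsto (FracInt.newtonSum ρ α (FracInt.integOp a b)) atTop
          (𝓝 (FracInt.riemannLiouvilleOp a b α hα))) ∧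
    -- arbitrary intervals: identity in `L¹(a, c)` for every finite `c ≤ b`
    (∀ (a b : EReal) (f : ℝ → ℂ) (ρ : ℝ), a < b → 0 < ρ →
      IntegrableOn f (FracInt.interval a b) →
      (a = ⊥ → ∃ ε : ℝ, 1 / ρ < ε ∧
        f =O[atBot ⊓ ae volume] fun x => Real.exp (ε * x)) →
      ∀ c : ℝ, (c : EReal) ≤ b →
        (∀ k : ℕ, IntegrableOn ((FracInt.integ a)^[k] f) (FracInt.interval a c)) ∧
        (∀ᵐ x ∂(volume.restrict (FracInt.interval a c)),
          IntegrableOn (fun y => f y * ((x - y : ℝ) : ℂ) ^ (α - 1)) (FracInt.interval a x)) ∧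
        IntegrableOn (FracInt.riemannLiouville a α f) (FracInt.interval a c) ∧
        Tendsto (fun N => eLpNorm
            (fun x => FracInt.newtonSumFun a ρ α f N x - FracInt.riemannLiouville a α f x) 1
            (volume.restrict (FracInt.interval a c)))
          atTop (𝓝 0)) := by
  refine ⟨fun a b hab => ⟨?_, fun ρ hρ => FracInt.tendsto_newtonSum_integOp hα a b hρ⟩, ?_⟩
  · have hspec : spectrum ℂ (FracInt.integOp a b) ⊆ Metric.closedBall ((1 : ℝ) : ℂ) 1 :=
      (FracInt.spectrum_integOp_subset hab.le).trans (by simp)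
    exact FracInt.isFractionalPower_of_tendsto_newtonSum one_pos hspec
      (FracInt.tendsto_newtonSum_integOp hα a b one_pos)
  · intro a b f ρ hab hρ hf hO c hc
    have hfc : IntegrableOn f (FracInt.interval a c) :=
      hf.mono_set (FracInt.interval_subset_interval_right a hc)
    obtain ⟨η, hη, hfη⟩ :=
      FracInt.exists_expIntegrable hab.ne_top (one_div_pos.2 hρ).le hfc hO
    have hη₀ : 0 < η := (one_div_pos.2 hρ).trans hη
    refine ⟨fun k => ?_, FracInt.ae_integrableOn_riemannLiouville hη₀ hα hfη,
      FracInt.integrableOn_riemannLiouville hη₀ hα hfη,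
      FracInt.tendsto_eLpNorm_newtonSumFun_sub hρ hη hα hfc hfη⟩
    cases k with
    | zero => exact hfc
    | succ k => exact FracInt.integrableOn_iterate_integ_succ hη₀ hfη k
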